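/- Theorem. A planar tensor network is Clifford if and only if it can be represented by a 2D Quon diagram that contains no generic scattering element. Here the notions are as follows. Planar tensor networks. All leg indices take values in $\{0,1\}$. A planar tensor network is built from tensors of arbitrary degree, each placed in a disk with its legs in counterclockwise order, by planar operations on connected planar regions carrying the networks: renaming of legs, merging of two regions along boundary segments, enlarging the region by an empty strip, and contraction of two open legs on the same boundary circle of the region. It has a tensor $T\colon\{0,1\}^{\iota}\to\mathbb C$, where $\iota$ is the set of open legs, and a layout, i.e. the cyclic order of the open legs on each oriented boundary circle of the region. It is called Clifford if there are $c\in\mathbb C\setminus\{0\}$ and a planar tensor network with the same layout of open legs and tensor $T'$, all of whose constituent tensors belong to $\{|0\rangle,\ I,\ e^{\pm i\frac{\pi}{4}X},\ e^{\pm i\frac{\pi}{4}Z},\ P\}$, such that $T=cT'$; here $P$ is the $3$-leg parity tensor ($1$ if the sum of its indices is even, $0$ if it is odd). 2D Quon diagrams. A 2D Quon diagram is a background manifold (a compact surface in the plane, read from top to bottom; each generic horizontal slice is a row of intervals) with a Majorana diagram drawn in it and a complex scalar coefficient. Every interval of a slice carries an even number of strings. If the slice has $2n$ strings in total, its state space is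 $(\mathbb C^2)^{\otimes n}$, with Majorana operators $\gamma_{2k-1}=Z_1\cdots Z_{k-1}X_k$ and $\gamma_{2k}=iZ_1\cdots Z_kX_k$. The pieces are interpreted as follows. - Cap: pair creation, $|p_1,\dots\rangle\mapsto 2^{1/4}|\dots,p_{k-1},0,p_k,\dots\rangle$ if the new strings are $2k-1,2k$, and $|p_1,\dots\rangle\mapsto 2^{-1/4}\sum_{p}|\dots,p_{k-1},p,p+p_k,p_{k+1},\dots\rangle$ if they are $2k,2k+1$. Cup: the adjoint. - Simultaneous pair of dots on strings $a<b$ of one interval: $i\gamma_a\gamma_b$. - Positive and negative braid of strings $j,j+1$: $\frac{e^{\mp i\pi/8}}{\sqrt2}(1\pm i\,Q)$ with $Q=i\gamma_j\gamma_{j+1}$. - Scattering element of angle $\theta\in\mathbb C$ on strings $j,j+1$: $\frac{1+e^{i\theta}}2+\frac{1-e^{i\theta}}2Q$ (arrow along time), or $\frac{1+e^{i\theta}}2E+\frac{1-e^{i\theta}}2\gamma_{j+1}E\gamma_{j+1}$ (arrow across time), where $E$ is a cup followed by a cap. It is generic if $\theta\notin\frac{\pi}{2}\mathbb Z$. - Background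 manifold: an interval without strings may begin or end, and neighbouring intervals may be joined (no factor); an interval may split into two intervals, each of which is then projected to even fermion parity. - Open intervals: an interval with four strings may begin or end at an open interval of the boundary, to which a tensor leg $j\in\{0,1\}$ is attached by the basis encoder, i.e. the ket (or its adjoint bra) of two nested caps, with a pair of dots on the two right strings if $j=1$. A diagram that starts and ends with the empty slice, and in which each leg of $\iota$ occurs exactly once, thus yields a tensor on $\{0,1\}^{\iota}$. It represents a planar tensor network if the two tensors are equal and the cyclic order of the tensor legs along the oriented boundary circles of the background manifold is the layout of the open legs of the network. -/

import Mathlib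

open Complex

noncomputable section

namespace Quon

/-! ## Cyclic orders of legs along oriented boundary circles -/

/-- The transposition of `a` and `b` (with classical decidability of equality). -/
def transp {α : Type} (a b : α) : Equiv.Perm α :=
  @Equiv.swap α (Classical.decEq α) a b

/-- Delete the point `z` from its cycle: `… x → z → y …` becomes `… x → y …`, and `z` is fixed. -/
def delete {α : Type} (z : α) (f : Equiv.Perm α) : Equiv.Perm α :=
  transp z (f z) * f

/-! ## Planar tensor networks

Every leg index takes the values `0`, `1` (here `false`, `true`). -/

/-- Planar tensor networks laid out in a connected planar region `R`.

`ι` is the set of (names of) open legs.  The permutation `σ` is the layout of the open legs on the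
boundary of `R`: when the boundary circles of `R` are traversed with `R` on the left-hand side, the
open leg met next after `ℓ` is `σ ℓ`, so the cycles of `σ` are the boundary circles that carry legs,
with their cyclic order.

The constructors are a single tensor and the planar operations: renaming of legs (which contains the
cyclic shift of the starting point on a boundary circle), merging of two regions, enlarging the
region by an empty strip, and contraction of two legs on the same boundary circle. -/
inductive PlanarTN : (ι : Type) → Equiv.Perm ι → Type 1
  /-- A single tensor in a disk, with its legs in counterclockwise order. -/
  | node (n : ℕ) (T : (Fin n → Bool) → ℂ) : PlanarTN (Fin n) (finRotate n)
  /-- A change of the names of the legs; the layout is carried along. -/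
  | relabel {ι κ : Type} {σ : Equiv.Perm ι} (e : ι ≃ κ) (N : PlanarTN ι σ) :
      PlanarTN κ (e.permCongr σ)
  /-- Two regions are merged along two boundary segments without legs, the one that follows the leg
  `a` of the first region and the one that follows the leg `b` of the second. -/
  | merge {ι κ : Type} {σ : Equiv.Perm ι} {τ : Equiv.Perm κ} (a : ι) (b : κ)
      (N : PlanarTN ι σ) (M : PlanarTN κ τ) :
      PlanarTN (ι ⊕ κ) (Equiv.sumCongr σ τ * transp (Sum.inl a) (Sum.inr b))
  /-- Two regions are merged along boundary circles at least one of which carries no leg. -/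
  | mergeBlank {ι κ : Type} {σ : Equiv.Perm ι} {τ : Equiv.Perm κ}
      (N : PlanarTN ι σ) (M : PlanarTN κ τ) :
      PlanarTN (ι ⊕ κ) (Equiv.sumCongr σ τ)
  /-- The region is enlarged by an empty strip that joins the boundary segments following the legs
  `a` and `b` of one boundary circle; this circle is split into two. -/
  | strip {ι : Type} {σ : Equiv.Perm ι} (a b : ι) (hab : a ≠ b) (h : σ.SameCycle a b)
      (N : PlanarTN ι σ) : PlanarTN ι (σ * transp a b)
  /-- Contraction of the two legs `none` and `some none`, which lie on the same boundary circle
  `none, u₁, …, uₖ, some none, v₁, …, vₗ`; the circle is split into `u₁, …, uₖ` and `v₁, …, vₗ`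
  (neighbouring legs if `k = 0` or `l = 0`). -/
  | contract {κ : Type} {σ : Equiv.Perm (Option (Option κ))}
      (h : σ.SameCycle none (some none)) (N : PlanarTN (Option (Option κ)) σ) :
      PlanarTN κ (Equiv.removeNone (Equiv.removeNone (σ * transp none (some none))))

namespace PlanarTN

/-- The tensor obtained by carrying out all contractions. -/
def eval : {ι : Type} → {σ : Equiv.Perm ι} → PlanarTN ι σ → (ι → Bool) → ℂ
  | _, _, node _ T => T
  | _, _, relabel e N => fun x => N.eval (x ∘ e)
  | _, _, merge _ _ N M => fun x => N.eval (x ∘ Sum.inl) * M.eval (x ∘ Sum.inr)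
  | _, _, mergeBlank N M => fun x => N.eval (x ∘ Sum.inl) * M.eval (x ∘ Sum.inr)
  | _, _, strip _ _ _ _ N => N.eval
  | _, _, contract _ N => fun x => ∑ b : Bool, N.eval (fun o => o.elim b (fun o' => o'.elim b x))

/-- Every constituent tensor of the network satisfies `S`. -/
def AllNodes (S : (n : ℕ) → ((Fin n → Bool) → ℂ) → Prop) :
    {ι : Type} → {σ : Equiv.Perm ι} → PlanarTN ι σ → Prop
  | _, _, node n T => S n T
  | _, _, relabel _ N => N.AllNodes S
  | _, _, merge _ _ N M => N.AllNodes S ∧ M.AllNodes S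
  | _, _, mergeBlank N M => N.AllNodes S ∧ M.AllNodes S
  | _, _, strip _ _ _ _ N => N.AllNodes S
  | _, _, contract _ N => N.AllNodes S

end PlanarTN

/-! ## Clifford tensor networks -/

/-- The Pauli matrices `X` and `Z`, with `0 = false`, `1 = true`. -/
def pauliX : Matrix Bool Bool ℂ := fun a b => if a = b then 0 else 1

def pauliZ : Matrix Bool Bool ℂ := fun a b => if a = b then (if a then -1 else 1) else 0

/-- `e^{iθA} = cos θ + i sin θ A` for an involution `A`. -/
def expI (θ : ℝ) (A : Matrix Bool Bool ℂ) : Matrix Bool Bool ℂ :=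
  (Real.cos θ : ℂ) • (1 : Matrix Bool Bool ℂ) + (I * (Real.sin θ : ℂ)) • A

/-- A matrix, read as a two-leg tensor. -/
def twoLeg (A : Matrix Bool Bool ℂ) : (Fin 2 → Bool) → ℂ := fun x => A (x 0) (x 1)

/-- The tensor of `|0⟩`. -/
def ketZero : (Fin 1 → Bool) → ℂ := fun x => if x 0 then 0 else 1

/-- The three-leg parity tensor: `1` if the sum of the indices is even, `0` otherwise. -/
def parityTensor : (Fin 3 → Bool) → ℂ :=
  fun x => if xor (x 0) (xor (x 1) (x 2)) then 0 else 1

/-- The Clifford generating set `|0⟩`, `I`, `e^{±iπX/4}`, `e^{±iπZ/4}`, `P`. -/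
inductive CliffordGenerator : (n : ℕ) → ((Fin n → Bool) → ℂ) → Prop
  | ketZero : CliffordGenerator 1 ketZero
  | identity : CliffordGenerator 2 (twoLeg 1)
  | expX : CliffordGenerator 2 (twoLeg (expI (Real.pi / 4) pauliX))
  | expXneg : CliffordGenerator 2 (twoLeg (expI (-(Real.pi / 4)) pauliX))
  | expZ : CliffordGenerator 2 (twoLeg (expI (Real.pi / 4) pauliZ))
  | expZneg : CliffordGenerator 2 (twoLeg (expI (-(Real.pi / 4)) pauliZ))
  | parity : CliffordGenerator 3 parityTensor

/-- A planar tensor network is Clifford if, up to a nonzero scalar, its tensor is that of a planar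
tensor network with the same layout of open legs all of whose constituents are Clifford
generators. -/
def PlanarTN.IsClifford {ι : Type} {σ : Equiv.Perm ι} (N : PlanarTN ι σ) : Prop :=
  ∃ M : PlanarTN ι σ, M.AllNodes CliffordGenerator ∧
    ∃ c : ℂ, c ≠ 0 ∧ ∀ x, N.eval x = c * M.eval x

/-! ## Majorana operators on Fock space

A state of `2n` Majorana strings is given by its amplitudes on the occupation basis
`|p₁, …, pₙ⟩`, a list of `n` bits.  Only lists of the right length are ever read.  Strings are
counted from `0`, from left to right. -/

/-- Amplitudes in the occupation basis. -/
abbrev Amp : Type := List Bool → ℂ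

/-- The scalar `2^{1/4}`. -/
def fourthRootTwo : ℂ := ((2 : ℝ) ^ (1 / 4 : ℝ) : ℝ)

/-- A dot on the string number `k` (counted from `0`), in Jordan–Wigner form:
`Z₁ ⋯ Z_q X_{q+1}` if `k = 2q` and `i Z₁ ⋯ Z_q Z_{q+1} X_{q+1}` if `k = 2q + 1`. -/
def majorana (k : ℕ) (ψ : Amp) : Amp := fun p =>
  (if k % 2 = 1 then I else 1) * (-1) ^ ((p.take (k / 2 + k % 2)).count true) *
    ψ (p.modify (k / 2) not)

/-- A simultaneous pair of dots on the strings `a < b`: the operator `i γ_a γ_b`. -/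
def dotPair (a b : ℕ) (ψ : Amp) : Amp := I • majorana a (majorana b ψ)

/-- Pair creation (a cap) of two strings to the right of the first `k` strings: with `k = 2q`,
`|p₁, …⟩ ↦ 2^{1/4} |p₁, …, p_q, 0, p_{q+1}, …⟩`, and with `k = 2q + 1`,
`|p₁, …⟩ ↦ 2^{-1/4} ∑_b |p₁, …, p_q, b, b + p_{q+1}, p_{q+2}, …⟩`. -/
def capAt (k : ℕ) (ψ : Amp) : Amp := fun p =>
  if k % 2 = 0 then
    match p.drop (k / 2) with
    | b :: r => if b then 0 else fourthRootTwo * ψ (p.take (k / 2) ++ r)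
    | [] => 0
  else
    match p.drop (k / 2) with
    | a :: b :: r => fourthRootTwo⁻¹ * ψ (p.take (k / 2) ++ xor a b :: r)
    | _ => 0

/-- Pair annihilation (a cup) of the two strings to the right of the first `k` strings, the adjoint
of pair creation. -/
def cupAt (k : ℕ) (ψ : Amp) : Amp := fun p =>
  if k % 2 = 0 then
    fourthRootTwo * ψ (p.take (k / 2) ++ false :: p.drop (k / 2))
  else
    match p.drop (k / 2) with
    | a :: r => fourthRootTwo⁻¹ * ∑ b : Bool, ψ (p.take (k / 2) ++ b :: xor b a :: r)
    | [] => 0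

/-- The positive (`true`) and the negative (`false`) braid of the strings `k` and `k + 1`:
`e^{∓iπ/8} (1 ± i (i γ_k γ_{k+1})) / √2`. -/
def braidAt (positive : Bool) (k : ℕ) (ψ : Amp) : Amp :=
  if positive then
    (exp (-(I * (Real.pi / 8))) / (Real.sqrt 2 : ℂ)) • (ψ + I • dotPair k (k + 1) ψ)
  else
    (exp (I * (Real.pi / 8)) / (Real.sqrt 2 : ℂ)) • (ψ - I • dotPair k (k + 1) ψ)

/-- The scattering element of angle `θ` on the strings `k` and `k + 1`, with the string endpoints
connected along the time direction. -/
def scatterVert (θ : ℂ) (k : ℕ) (ψ : Amp) : Amp :=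
  ((1 + exp (I * θ)) / 2) • ψ + ((1 - exp (I * θ)) / 2) • dotPair k (k + 1) ψ

/-- The scattering element of angle `θ` on the strings `k` and `k + 1`, with the string endpoints
connected across the time direction: cup followed by cap, without or with a dot on the right end of
each. -/
def scatterHoriz (θ : ℂ) (k : ℕ) (ψ : Amp) : Amp :=
  ((1 + exp (I * θ)) / 2) • capAt k (cupAt k ψ) +
    ((1 - exp (I * θ)) / 2) • majorana (k + 1) (capAt k (cupAt k (majorana (k + 1) ψ)))

/-- The projection `(1 + P) / 2` to even parity of the `2m` strings that follow the first `2q`. -/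
def evenProj (q m : ℕ) (ψ : Amp) : Amp := fun p =>
  if Even (((p.drop q).take m).count true) then ψ p else 0

/-- The basis encoder for the value `j`, as a ket on four new strings to the right of the first `k`
strings: two nested caps, with a pair of dots on the two right strings if `j = 1`. -/
def encoderKet (j : Bool) (k : ℕ) (ψ : Amp) : Amp :=
  let φ := capAt (k + 1) (capAt k ψ)
  if j then dotPair (k + 2) (k + 3) φ else φ

/-- The basis encoder for the value `j`, as a bra on the four strings to the right of the first `k`
strings. -/
def encoderBra (j : Bool) (k : ℕ) (ψ : Amp) : Amp :=
  cupAt k (cupAt (k + 1) (if j then dotPair (k + 2) (k + 3) ψ else ψ))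

/-! ## 2D Quon diagrams

A diagram is read from top to bottom.  A generic horizontal slice of the background manifold is a
row of disjoint intervals, each of which carries an even number of strings. -/

/-- A slice: its intervals from left to right, each with a name and with its number of strings. -/
abbrev Slice : Type := List (ℕ × ℕ)

/-- The number of strings in a slice. -/
def Slice.strings (s : Slice) : ℕ := (s.map Prod.snd).sum

/-- The names of the intervals of a slice. -/
def Slice.names (s : Slice) : List ℕ := s.map Prod.fst

/-- The part of a 2D Quon diagram above a slice, built from top to bottom by elementary pieces.
Open intervals of the boundary of the background manifold carry four strings; a basis encoder with a
tensor leg, whose name is in `ι`, is glued to each of them. -/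
inductive Partial (ι : Type) : Slice → Type
  | empty : Partial ι []
  -- Majorana diagram
  /-- Creation of a pair of strings. -/
  | cap {l r : Slice} {c : ℕ} (i j : ℕ) (D : Partial ι (l ++ (c, i + j) :: r)) :
      Partial ι (l ++ (c, i + 2 + j) :: r)
  /-- Annihilation of a pair of strings. -/
  | cup {l r : Slice} {c : ℕ} (i j : ℕ) (D : Partial ι (l ++ (c, i + 2 + j) :: r)) :
      Partial ι (l ++ (c, i + j) :: r)
  /-- A simultaneous pair of dots on two strings of the same interval. -/
  | dots {l r : Slice} {c : ℕ} (i m j : ℕ) (D : Partial ι (l ++ (c, i + 1 + m + 1 + j) :: r)) :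
      Partial ι (l ++ (c, i + 1 + m + 1 + j) :: r)
  /-- A positive or negative braid of two neighbouring strings. -/
  | braid {l r : Slice} {c : ℕ} (positive : Bool) (i j : ℕ)
      (D : Partial ι (l ++ (c, i + 2 + j) :: r)) : Partial ι (l ++ (c, i + 2 + j) :: r)
  /-- A scattering element with its arrow along the time direction. -/
  | scatterV {l r : Slice} {c : ℕ} (θ : ℂ) (i j : ℕ)
      (D : Partial ι (l ++ (c, i + 2 + j) :: r)) : Partial ι (l ++ (c, i + 2 + j) :: r)
  /-- A scattering element with its arrow across the time direction. -/
  | scatterH {l r : Slice} {c : ℕ} (θ : ℂ) (i j : ℕ)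
      (D : Partial ι (l ++ (c, i + 2 + j) :: r)) : Partial ι (l ++ (c, i + 2 + j) :: r)
  -- Background manifold
  /-- A new interval without strings (a local maximum of the background manifold). -/
  | birth {l r : Slice} (c : ℕ) (hc : c ∉ Slice.names (l ++ r)) (D : Partial ι (l ++ r)) :
      Partial ι (l ++ (c, 0) :: r)
  /-- An interval without strings ends (a local minimum of the background manifold). -/
  | death {l r : Slice} {c : ℕ} (D : Partial ι (l ++ (c, 0) :: r)) : Partial ι (l ++ r)
  /-- An interval splits into two, with `2i` and `2j` strings. -/
  | split {l r : Slice} {c : ℕ} (c' i j : ℕ)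
      (hc : c' ∉ Slice.names (l ++ (c, 2 * i + 2 * j) :: r))
      (D : Partial ι (l ++ (c, 2 * i + 2 * j) :: r)) :
      Partial ι (l ++ (c, 2 * i) :: (c', 2 * j) :: r)
  /-- Two neighbouring intervals are joined. -/
  | join {l r : Slice} {c c' m n : ℕ} (D : Partial ι (l ++ (c, m) :: (c', n) :: r)) :
      Partial ι (l ++ (c, m + n) :: r)
  -- Open intervals, with basis encoders
  /-- An open interval facing up, where the tensor leg `ℓ` comes in. -/
  | legIn {l r : Slice} (ℓ : ι) (c : ℕ) (hc : c ∉ Slice.names (l ++ r)) (D : Partial ι (l ++ r)) :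
      Partial ι (l ++ (c, 4) :: r)
  /-- An open interval facing down, where the tensor leg `ℓ` goes out. -/
  | legOut {l r : Slice} {c : ℕ} (ℓ : ι) (D : Partial ι (l ++ (c, 4) :: r)) : Partial ι (l ++ r)

namespace Partial

variable {ι : Type}

/-- The state on the slice, for given values of the tensor legs.  Where an interval splits, each of
the two new intervals is projected to even parity. -/
def amp (x : ι → Bool) : {s : Slice} → Partial ι s → Amp
  | _, empty => fun p => if p = [] then 1 else 0
  | _, cap (l := l) i _ D => capAt (l.strings + i) (D.amp x)
  | _, cup (l := l) i _ D => cupAt (l.strings + i) (D.amp x)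
  | _, dots (l := l) i m _ D => dotPair (l.strings + i) (l.strings + i + 1 + m) (D.amp x)
  | _, braid (l := l) positive i _ D => braidAt positive (l.strings + i) (D.amp x)
  | _, scatterV (l := l) θ i _ D => scatterVert θ (l.strings + i) (D.amp x)
  | _, scatterH (l := l) θ i _ D => scatterHoriz θ (l.strings + i) (D.amp x)
  | _, birth _ _ D => D.amp x
  | _, death D => D.amp x
  | _, split (l := l) _ i j _ D =>
      evenProj (l.strings / 2) i (evenProj (l.strings / 2 + i) j (D.amp x))
  | _, join D => D.amp x
  | _, legIn (l := l) ℓ _ _ D => encoderKet (x ℓ) l.strings (D.amp x)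
  | _, legOut (l := l) ℓ D => encoderBra (x ℓ) l.strings (D.amp x)

/-- The boundary of the background manifold above the slice, traversed with the manifold on the
left-hand side, as a permutation of tensor legs and intervals of the slice (unused names are fixed).
An interval stands for the part of the manifold below it: it is reached down its left end, and left
up its right end. -/
def boundary : {s : Slice} → Partial ι s → Equiv.Perm (ι ⊕ ℕ)
  | _, empty => 1
  | _, cap _ _ D => D.boundary
  | _, cup _ _ D => D.boundary
  | _, dots _ _ _ D => D.boundary
  | _, braid _ _ _ D => D.boundary
  | _, scatterV _ _ _ D => D.boundary
  | _, scatterH _ _ _ D => D.boundary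
  | _, birth _ _ D => D.boundary
  | _, death (c := c) D => delete (Sum.inr c) D.boundary
  | _, split (c := c) c' _ _ _ D => D.boundary * transp (Sum.inr c) (Sum.inr c')
  | _, join (c := c) (c' := c') D =>
      delete (Sum.inr c') (D.boundary * transp (Sum.inr c) (Sum.inr c'))
  | _, legIn ℓ c _ D => D.boundary * transp (Sum.inl ℓ) (Sum.inr c)
  | _, legOut (c := c) ℓ D =>
      transp (Sum.inl ℓ) (Sum.inr c) * D.boundary * transp (Sum.inl ℓ) (Sum.inr c)

/-- The tensor legs of the diagram. -/
def legs : {s : Slice} → Partial ι s → List ι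
  | _, empty => []
  | _, cap _ _ D => D.legs
  | _, cup _ _ D => D.legs
  | _, dots _ _ _ D => D.legs
  | _, braid _ _ _ D => D.legs
  | _, scatterV _ _ _ D => D.legs
  | _, scatterH _ _ _ D => D.legs
  | _, birth _ _ D => D.legs
  | _, death D => D.legs
  | _, split _ _ _ _ D => D.legs
  | _, join D => D.legs
  | _, legIn ℓ _ _ D => ℓ :: D.legs
  | _, legOut ℓ D => ℓ :: D.legs

/-- No scattering element is generic: every scattering angle is an integer multiple of `π / 2`. -/
def NoGenericScattering : {s : Slice} → Partial ι s → Prop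
  | _, empty => True
  | _, cap _ _ D => D.NoGenericScattering
  | _, cup _ _ D => D.NoGenericScattering
  | _, dots _ _ _ D => D.NoGenericScattering
  | _, braid _ _ _ D => D.NoGenericScattering
  | _, scatterV θ _ _ D => (∃ k : ℤ, θ = k * (Real.pi / 2)) ∧ D.NoGenericScattering
  | _, scatterH θ _ _ D => (∃ k : ℤ, θ = k * (Real.pi / 2)) ∧ D.NoGenericScattering
  | _, birth _ _ D => D.NoGenericScattering
  | _, death D => D.NoGenericScattering
  | _, split _ _ _ _ D => D.NoGenericScattering
  | _, join D => D.NoGenericScattering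
  | _, legIn _ _ _ D => D.NoGenericScattering
  | _, legOut _ D => D.NoGenericScattering

end Partial

/-- A 2D Quon diagram with the set `ι` of tensor legs, with a scalar coefficient. -/
structure Diagram (ι : Type) where
  /-- The scalar coefficient. -/
  coeff : ℂ
  /-- The diagram, from the empty slice at the top to the empty slice at the bottom. -/
  body : Partial ι []
  /-- No tensor leg occurs twice. -/
  legs_nodup : body.legs.Nodup
  /-- Every tensor leg occurs. -/
  mem_legs : ∀ ℓ : ι, ℓ ∈ body.legs

namespace Diagram

variable {ι : Type}

/-- The tensor of a 2D Quon diagram. -/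
def tensor (D : Diagram ι) (x : ι → Bool) : ℂ := D.coeff * D.body.amp x []

/-- The diagram contains no generic scattering element. -/
def NoGenericScattering (D : Diagram ι) : Prop := D.body.NoGenericScattering

/-- The diagram represents the planar tensor network: it has the same tensor, and its legs have the
same layout along the boundary. -/
def Represents (D : Diagram ι) {σ : Equiv.Perm ι} (N : PlanarTN ι σ) : Prop :=
  (∀ x, D.tensor x = N.eval x) ∧ D.body.boundary = Equiv.sumCongr σ 1

end Diagram

end Quon

end

open Complex

namespace Quon

/-! Both notions are compared with a third one, `CliffordSum`: a scalar times a sum of powers of i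
over hidden bits, the exponent being built from linear terms and doubled products of bits. This
class is closed under products, identification of variables, summation and affine substitution, by
Fourier expansion of indicator functions.

Both sides produce such tensors. Every Clifford generator is a Clifford sum, and contraction
preserves the class (`PlanarTN.AllNodes.cliffordSum`). In a diagram, a dot pair on neighbouring
strings is Z on one mode or X ⊗ X on two adjacent modes, so braids and scattering elements are
either diagonal or combinations of the identity and a double flip. Their two coefficients have ratio
e^{iθ}, a power of i, or are (1 ± e^{iθ})/2; for θ in (π/2)ℤ these also have ratio ±i, or one of
them vanishes. Hence all amplitudes are Clifford sums in leg values and occupation numbers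
(`Partial.cliffordAmp`).

Conversely, both sides realize every Clifford sum with every layout. Gates on neighbouring variables
suffice, since a swap is three controlled negations and each of these is a Hadamard conjugate of a
controlled phase; thus planarity does not restrict the tensor (`CliffordClosed.of_cliffordSum`).
Networks implement these gates by parity tensors and one-qubit rotations
(`Realizable.cliffordClosed`). Diagrams encode a qubit on four strings, i.e. two modes, as |a⟩ ↦
|aa⟩: braids give the one-qubit gates, nested cups merge two qubits, and nested caps followed by the
parity projection of a split copy a qubit; together they give the controlled phase
(`Preparable.cliffordClosed`).

The layout is arranged separately. For networks all legs lie on one circle, which strips cut into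
the cycles of σ (`CliffordSum.realizable`). For diagrams the legs are read out cycle by cycle, each
cycle around a hole of its own (`readable`, `CliffordSum.exists_diagram`). -/

/-- Tensors that are, up to a scalar, partial sums of phases `i ^ q`, where `q` is a sum of variables
and of doubled products of two variables. -/
inductive CliffordSum : {V : Type} → ((V → Bool) → ℂ) → Prop
  | const {V : Type} (c : ℂ) : CliffordSum (fun _ : V → Bool => c)
  | phase {V : Type} {T : (V → Bool) → ℂ} (v : V) (h : CliffordSum T) :
      CliffordSum (fun z => (if z v then I else 1) * T z)
  | cz {V : Type} {T : (V → Bool) → ℂ} (v w : V) (h : CliffordSum T) :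
      CliffordSum (fun z => (if z v && z w then -1 else 1) * T z)
  | sum {V : Type} {T : (Option V → Bool) → ℂ} (h : CliffordSum T) :
      CliffordSum (fun z => ∑ b : Bool, T (fun o => o.elim b z))

/-! ### Closure properties of Clifford sums -/

namespace CliffordSum

variable {V W : Type}

theorem congr {T S : (V → Bool) → ℂ} (h : CliffordSum T) (e : ∀ z, S z = T z) : CliffordSum S := by
  obtain rfl : S = T := funext e
  exact h

/-- The map `f` need be neither injective nor surjective: variables may be renamed, identified, or
added as dummies. Contraction is an identification followed by a summation. -/
theorem pullback {T : (V → Bool) → ℂ} (h : CliffordSum T) (f : V → W) :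
    CliffordSum (fun z => T (z ∘ f)) := by
  induction h generalizing W with
  | const c => exact const c
  | phase v _ ih => exact (ih f).phase (f v)
  | cz v w _ ih => exact (ih f).cz (f v) (f w)
  | sum _ ih =>
    refine (ih (Option.map f)).sum.congr fun z => ?_
    refine Finset.sum_congr rfl fun b _ => congrArg _ (funext fun o => ?_)
    cases o <;> rfl

theorem const_mul {T : (V → Bool) → ℂ} (h : CliffordSum T) (c : ℂ) :
    CliffordSum (fun z => c * T z) := by
  induction h with
  | const d => exact const (c * d)
  | phase v _ ih => exact (ih.phase v).congr fun z => by ring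
  | cz v w _ ih => exact (ih.cz v w).congr fun z => by ring
  | sum _ ih => exact ih.sum.congr fun z => by rw [Finset.mul_sum]

theorem mul {T S : (V → Bool) → ℂ} (hT : CliffordSum T) (hS : CliffordSum S) :
    CliffordSum (fun z => T z * S z) := by
  induction hT with
  | const d => exact hS.const_mul d
  | phase v _ ih => exact ((ih hS).phase v).congr fun z => by ring
  | cz v w _ ih => exact ((ih hS).cz v w).congr fun z => by ring
  | sum _ ih => exact (ih (hS.pullback some)).sum.congr fun z => by rw [Finset.sum_mul]; rfl

theorem sign (v w : V) : CliffordSum (fun z : V → Bool => if z v && z w then -1 else 1) :=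
  ((const 1).cz v w).congr fun z => by simp

theorem sign_self (v : V) : CliffordSum (fun z : V → Bool => if z v then -1 else 1) :=
  (sign v v).congr fun z => by simp

theorem ite_I_pow (v : V) (k : ℕ) :
    CliffordSum (fun z : V → Bool => if z v then I ^ k else 1) := by
  induction k with
  | zero => exact (const 1).congr fun z => by simp
  | succ k ih => exact (ih.phase v).congr fun z => by split_ifs <;> ring

/-- Fourier expansion of an indicator: average (-1)^{t(u+a+b)} over a fresh bit t. The other
indicator functions below arise in the same way. -/
theorem parity (u a b : V) :
    CliffordSum (fun z : V → Bool => if xor (z u) (xor (z a) (z b)) then 0 else 1) := by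
  have h := ((sign (V := Option V) none (some u)).mul
    ((sign none (some a)).mul (sign none (some b)))).sum.const_mul (1 / 2)
  refine h.congr fun z => ?_
  cases hu : z u <;> cases ha : z a <;> cases hb : z b <;> norm_num [hu, ha, hb]

theorem ite_zero_one (v : V) : CliffordSum (fun z : V → Bool => if z v then 0 else 1) :=
  (parity v v v).congr fun z => by simp

theorem ite_one_zero (v : V) : CliffordSum (fun z : V → Bool => if z v then 1 else 0) := by
  have h := ((sign_self (V := Option V) none).mul (sign none (some v))).sum.const_mul (1 / 2)
  refine h.congr fun z => ?_
  cases hv : z v <;> norm_num [hv]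

theorem delta (u a : V) :
    CliffordSum (fun z : V → Bool => if xor (z u) (z a) then 0 else 1) := by
  have h := ((sign (V := Option V) none (some u)).mul (sign none (some a))).sum.const_mul (1 / 2)
  refine h.congr fun z => ?_
  cases hu : z u <;> cases ha : z a <;> norm_num [hu, ha]

/-- The new value of `v` becomes a summation variable `none`, which the indicator forces to equal `E
z`. As the indicator still sees the old variables, `E` may depend on the old value of `v`. -/
theorem update_of_delta [DecidableEq V] {T : (V → Bool) → ℂ} (h : CliffordSum T) (v : V)
    {E : (V → Bool) → Bool}
    (hE : CliffordSum fun z : Option V → Bool => if xor (z none) (E (z ∘ some)) then 0 else 1) :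
    CliffordSum (fun z => T (Function.update z v (E z))) := by
  refine (hE.mul (h.pullback (W := Option V)
    fun u => if u = v then none else some u)).sum.congr fun z => ?_
  have key : ∀ b : Bool, ((fun o : Option V => o.elim b z) ∘
      fun u => if u = v then none else some u) = Function.update z v b := fun b => by
    funext u
    by_cases hu : u = v
    · subst hu; simp
    · simp [hu]
  have hs : ∀ b : Bool, (fun o : Option V => o.elim b z) ∘ some = z := fun _ => rfl
  cases hz : E z <;> simp [key, hs, hz]

theorem update_xor [DecidableEq V] {T : (V → Bool) → ℂ} (h : CliffordSum T) (v a b : V) :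
    CliffordSum (fun z => T (Function.update z v (xor (z a) (z b)))) :=
  h.update_of_delta v (E := fun z => xor (z a) (z b)) (parity none (some a) (some b))

theorem update_const [DecidableEq V] {T : (V → Bool) → ℂ} (h : CliffordSum T) (v : V) (c : Bool) :
    CliffordSum (fun z => T (Function.update z v c)) := by
  refine h.update_of_delta v (E := fun _ => c) ?_
  cases c
  · exact (ite_zero_one none).congr fun z => by simp
  · exact (ite_one_zero none).congr fun z => by cases z none <;> simp

theorem update_not [DecidableEq V] {T : (V → Bool) → ℂ} (h : CliffordSum T) (v a : V) :
    CliffordSum (fun z => T (Function.update z v (!z a))) := by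
  refine h.update_of_delta v (E := fun z => !z a) ?_
  refine ((delta (none : Option V) (some a)).update_of_delta none (E := fun z => !z none)
    ?_).congr fun z => ?_
  -- The extra factor (-1)^t in the Fourier sum selects odd instead of even parity, so the two
  -- variables are forced to differ.
  · have h' := ((sign_self (V := Option (Option (Option V))) none).mul
      ((sign none (some none)).mul (sign none (some (some none))))).sum.const_mul (1 / 2)
    refine h'.congr fun z => ?_
    cases hu : z none <;> cases ha : z (some none) <;> norm_num [hu, ha]
  · cases ha : z (some a) <;> simp [Function.update, ha]

end CliffordSum

/-! ### Tensors of Clifford networks are Clifford sums -/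

namespace PlanarTN

/-- With i^k = i tan θ, the entries of e^{iθX} are cos θ · i^{k(a+b)} (-1)^{ab}, where a and b are
added as integers, and those of e^{iθZ} are cos θ (1 + i tan θ) δ_{ab} i^{3ka}. -/
theorem cliffordSum_expI (θ : ℝ) (hs : θ = Real.pi / 4 ∨ θ = -(Real.pi / 4)) :
    CliffordSum (twoLeg (expI θ pauliX)) ∧ CliffordSum (twoLeg (expI θ pauliZ)) := by
  obtain ⟨k, s, hk, hc, hsn⟩ : ∃ (k : ℕ) (s : ℂ), I ^ k = I * s ∧ ((Real.cos θ : ℝ) : ℂ) =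
      Real.cos (Real.pi / 4) ∧
      ((Real.sin θ : ℝ) : ℂ) = s * Real.cos (Real.pi / 4) ∧ s * s = 1 := by
    rcases hs with rfl | rfl
    · exact ⟨1, 1, by simp, rfl, by simp, by simp⟩
    · exact ⟨3, -1, by simp [pow_succ], by simp, by simp, by simp⟩
  have hI : I ^ k * I ^ k = -1 := by
    rw [hk]; linear_combination (s * s) * I_mul_I - hsn.2
  set r : ℂ := ((Real.cos (Real.pi / 4) : ℝ) : ℂ)
  constructor
  · have h := ((CliffordSum.ite_I_pow (0 : Fin 2) k).mul ((CliffordSum.ite_I_pow (1 : Fin 2) k).mul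
      (CliffordSum.sign (0 : Fin 2) 1))).const_mul r
    refine h.congr fun z => ?_
    simp only [twoLeg, expI, pauliX, Matrix.add_apply, Matrix.smul_apply, smul_eq_mul, hc, hsn.1,
      Matrix.one_apply]
    cases z 0 <;> cases z 1 <;> simp
    · rw [hk]; ring
    · rw [hk]; ring
    · linear_combination r * hI
  · have h := ((CliffordSum.delta (0 : Fin 2) 1).mul
      (CliffordSum.ite_I_pow (0 : Fin 2) (3 * k))).const_mul (r * (1 + I * s))
    refine h.congr fun z => ?_
    simp only [twoLeg, expI, pauliZ, Matrix.add_apply, Matrix.smul_apply, smul_eq_mul, hc, hsn.1,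
      Matrix.one_apply]
    cases z 0 <;> cases z 1 <;> simp
    · ring
    · rw [pow_mul', pow_three, hI, hk]
      linear_combination (r * s * s) * I_mul_I - r * hsn.2

theorem AllNodes.cliffordSum {ι : Type} {σ : Equiv.Perm ι} {N : PlanarTN ι σ}
    (h : N.AllNodes CliffordGenerator) : CliffordSum N.eval := by
  induction N with
  | node n T =>
    change CliffordSum T
    change CliffordGenerator n T at h
    cases h with
    | ketZero => exact CliffordSum.ite_zero_one 0
    | identity =>
      refine (CliffordSum.delta (0 : Fin 2) 1).congr fun z => ?_
      simp only [twoLeg, Matrix.one_apply]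
      cases z 0 <;> cases z 1 <;> simp
    | expX => exact (cliffordSum_expI _ (Or.inl rfl)).1
    | expXneg => exact (cliffordSum_expI _ (Or.inr rfl)).1
    | expZ => exact (cliffordSum_expI _ (Or.inl rfl)).2
    | expZneg => exact (cliffordSum_expI _ (Or.inr rfl)).2
    | parity => exact CliffordSum.parity 0 1 2
  | relabel e N ih => exact (ih h).pullback e
  | merge a b N M ihN ihM => exact ((ihN h.1).pullback Sum.inl).mul ((ihM h.2).pullback Sum.inr)
  | mergeBlank N M ihN ihM => exact ((ihN h.1).pullback Sum.inl).mul ((ihM h.2).pullback Sum.inr)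
  | strip a b hab hs N ih => exact ih h
  | contract hs N ih =>
    -- The two contracted legs are identified with one variable `none`, which is then summed.
    refine ((ih h).pullback (fun o : Option (Option _) => o.elim none fun o' => o')).sum.congr
      fun z => ?_
    refine Finset.sum_congr rfl fun b _ => congrArg _ (funext fun o => ?_)
    rcases o with _ | _ | o <;> rfl

end PlanarTN

/-! ### Gates on neighbouring variables generate all Clifford sums -/

/-- The unnormalized Hadamard gate on one variable. -/
def hadamard {V : Type} [DecidableEq V] (v : V) (T : (V → Bool) → ℂ) : (V → Bool) → ℂ :=
  fun z => ∑ b : Bool, (if b && z v then -1 else 1) * T (Function.update z v b)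

/-- The controlled phase gate on two variables. -/
def controlledZ {V : Type} (v w : V) (T : (V → Bool) → ℂ) : (V → Bool) → ℂ :=
  fun z => (if z v && z w then -1 else 1) * T z

/-- Families of tensors on `Fin n` that are closed under Clifford gates on single and on neighbouring
variables, and under summation of the first variable. -/
structure CliffordClosed (G : (n : ℕ) → ((Fin n → Bool) → ℂ) → Prop) : Prop where
  one : ∀ n, G n fun _ => 1
  smul : ∀ {n T} (c : ℂ), c ≠ 0 → G n T → G n fun z => c * T z
  phase : ∀ {n T} (i : Fin n), G n T → G n fun z => (if z i then I else 1) * T z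
  hadamard : ∀ {n T} (i : Fin n), G n T → G n (hadamard i T)
  controlledZ : ∀ {n T} (i : Fin n), G (n + 1) T → G (n + 1) (controlledZ i.castSucc i.succ T)
  sum : ∀ {n T}, G (n + 1) T → G n fun z => ∑ b : Bool, T (Fin.cons b z)

/-- The substitution of a controlled negation is a Hadamard conjugate of a controlled phase. -/
theorem hadamard_controlledZ_hadamard {V : Type} [DecidableEq V] {i j : V} (h : i ≠ j)
    (T : (V → Bool) → ℂ) (z : V → Bool) :
    hadamard j (controlledZ i j (hadamard j T)) z =
      2 * T (Function.update z j (xor (z j) (z i))) := by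
  simp only [hadamard, controlledZ, Function.update_self, Function.update_of_ne h,
    Function.update_idem, Fintype.sum_bool]
  cases hi : z i <;> cases hj : z j <;> simp <;> ring

/-- A swap is a product of three controlled negations with alternating control and target. -/
theorem comp_swap_eq_update {V : Type} [DecidableEq V] {i j : V} (h : i ≠ j) (z : V → Bool) :
    Function.update (Function.update (Function.update z j (xor (z j) (z i))) i
      (xor (z i) (xor (z j) (z i)))) j
      (xor (xor (z j) (z i)) (xor (z i) (xor (z j) (z i)))) = z ∘ Equiv.swap i j := by
  funext k
  by_cases hj : k = j
  · subst hj
    simp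
  by_cases hi : k = i
  · subst hi
    cases hj' : z j <;> simp [h, hj']
  · simp [hi, hj, Equiv.swap_apply_of_ne_of_ne]

namespace CliffordClosed

variable {G : (n : ℕ) → ((Fin n → Bool) → ℂ) → Prop}

/-- Closure under the controlled phase on this pair is a hypothesis, so that the lemma serves both
orientations of a neighbouring pair. -/
theorem controlledNot (hG : CliffordClosed G) {n : ℕ} {T : (Fin n → Bool) → ℂ} {i j : Fin n}
    (h : i ≠ j)
    (hc : ∀ S, G n S → G n (Quon.controlledZ i j S)) (hT : G n T) :
    G n fun z => T (Function.update z j (xor (z j) (z i))) := by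
  have := hG.smul (1 / 2) (by norm_num) (hG.hadamard j (hc _ (hG.hadamard j hT)))
  convert this using 2 with z
  rw [hadamard_controlledZ_hadamard h]
  ring

theorem comp_swap (hG : CliffordClosed G) {n : ℕ} {T : (Fin (n + 1) → Bool) → ℂ} (i : Fin n)
    (hT : G (n + 1) T) :
    G (n + 1) fun z => T (z ∘ Equiv.swap i.castSucc i.succ) := by
  have hne : i.castSucc ≠ i.succ := (Fin.castSucc_lt_succ (i := i)).ne
  have h1 : ∀ S, G (n + 1) S → G (n + 1) (Quon.controlledZ i.castSucc i.succ S) :=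
    fun S hS => hG.controlledZ i hS
  have h2 : ∀ S, G (n + 1) S → G (n + 1) (Quon.controlledZ i.succ i.castSucc S) := by
    intro S hS
    convert h1 S hS using 1
    funext z
    simp only [Quon.controlledZ, Bool.and_comm]
  convert hG.controlledNot hne h1 (hG.controlledNot hne.symm h2 (hG.controlledNot hne h1 hT))
    using 2 with z
  rw [← comp_swap_eq_update hne]
  simp [hne, hne.symm]

theorem comp_perm (hG : CliffordClosed G) {n : ℕ} (π : Equiv.Perm (Fin n)) {T : (Fin n → Bool) → ℂ}
    (hT : G n T) :
    G n fun z => T (z ∘ π) := by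
  rcases n with _ | n
  · convert hT using 2 with z
    exact congrArg _ (Subsingleton.elim _ _)
  · have hπ : π ∈ Submonoid.closure
        (Set.range fun i : Fin n => Equiv.swap i.castSucc i.succ) := by
      rw [Equiv.Perm.mclosure_swap_castSucc_succ]; trivial
    induction hπ using Submonoid.closure_induction generalizing T with
    | mem x hx =>
      obtain ⟨i, rfl⟩ := hx
      exact hG.comp_swap i hT
    | one => exact hT
    | mul x y _ _ hx hy => exact hx (hy hT)

/-- Conjugation by a permutation that takes the positions 0 and 1 to `i` and `j`. -/
theorem controlledZ_any (hG : CliffordClosed G) {n : ℕ} (i j : Fin n) {T : (Fin n → Bool) → ℂ}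
    (hT : G n T) :
    G n (Quon.controlledZ i j T) := by
  by_cases hij : i = j
  · subst hij
    -- On a single variable the controlled phase is the sign (-1)^{z_i}, the square of the phase
    -- gate.
    convert hG.phase i (hG.phase i hT) using 1
    funext z
    simp only [Quon.controlledZ]
    cases z i <;> simp
    rw [← mul_assoc, I_mul_I]; ring
  obtain ⟨n, rfl⟩ : ∃ m, n = m + 2 := by
    refine ⟨n - 2, ?_⟩
    have := i.2
    have := j.2
    have : (i : ℕ) ≠ j := fun h => hij (Fin.ext h)
    omega
  set π : Equiv.Perm (Fin (n + 2)) :=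
    Equiv.swap 0 i * Equiv.swap 1 (Equiv.swap 0 i j)
  have h1 : π 1 = j := by simp [π]
  have h0 : π 0 = i := by
    have h : Equiv.swap 0 i j ≠ 0 := by
      rw [Ne, Equiv.swap_apply_eq_iff, Equiv.swap_apply_left]
      exact fun h => hij h.symm
    simp [π, Equiv.swap_apply_of_ne_of_ne (zero_ne_one (α := Fin (n + 2))) h.symm]
  convert hG.comp_perm π (hG.controlledZ (n := n + 1) 0 (hG.comp_perm π⁻¹ hT)) using 2 with z
  simp only [Quon.controlledZ, Function.comp, Fin.castSucc_zero, Fin.succ_zero_eq_one, h0, h1]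
  congr 2
  funext k
  simp

/-- Each constructor of a Clifford sum is a gate or a summation. The enumeration `e` is universally
quantified so that, in the summation step, the hidden variable can be given the first position. -/
theorem of_cliffordSum (hG : CliffordClosed G) {V : Type} {T : (V → Bool) → ℂ} (hT : CliffordSum T)
    :
    ∀ {n : ℕ} (e : V ≃ Fin n), G n fun z => T (z ∘ e) := by
  induction hT with
  | const c =>
    intro n e
    rcases eq_or_ne c 0 with rfl | hc
    -- Scaling by zero is not available; the zero tensor is obtained as the sum of (-1)^b over an
    -- extra variable.
    · convert hG.sum (hG.phase 0 (hG.phase 0 (hG.one (n + 1)))) using 2 with z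
      simp
    · simpa using hG.smul c hc (hG.one n)
  | phase v _ ih => exact fun e => hG.phase (e v) (ih e)
  | cz v w _ ih => exact fun e => hG.controlledZ_any (e v) (e w) (ih e)
  | sum _ ih =>
    intro n e
    convert hG.sum (ih (e.optionCongr.trans (finSuccEquiv n).symm)) using 2 with z
    refine Finset.sum_congr rfl fun b _ => congrArg _ (funext fun o => ?_)
    cases o <;> simp

end CliffordClosed

/-- A Hadamard gate as a product of phase gates and of a quarter rotation about the `X` axis. -/
theorem hadamard_eq_phase {V : Type} [DecidableEq V] (v : V) (T : (V → Bool) → ℂ) (z : V → Bool) :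
    hadamard v T z = (if z v then I else 1) * ∑ b : Bool, (if xor b (z v) then -I else 1) *
      ((if (Function.update z v b) v then I else 1) * T (Function.update z v b)) := by
  simp only [hadamard, Function.update_self, Fintype.sum_bool]
  cases hv : z v <;> simp
  · linear_combination T (Function.update z v true) * I_mul_I
  · linear_combination (T (Function.update z v false) - T (Function.update z v true)) * I_mul_I

/-! ### Clifford gates as planar networks -/

/-- A tensor is, up to a nonzero scalar, that of a planar network of Clifford generators with layout
`σ`. -/
def Realizable {V : Type} (σ : Equiv.Perm V) (T : (V → Bool) → ℂ) : Prop :=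
  ∃ M : PlanarTN V σ, M.AllNodes CliffordGenerator ∧ ∃ c : ℂ, c ≠ 0 ∧ ∀ x, T x = c * M.eval x

/-- The layout with a new leg `none` inserted after the leg `v`. -/
noncomputable def insertAfter {V : Type} (σ : Equiv.Perm V) (v : V) : Equiv.Perm (Option V) :=
  σ.optionCongr * transp (some v) none

theorem transp_apply {V : Type} [inst : DecidableEq V] (a b x : V) :
    transp a b x = if x = a then b else if x = b then a else x := by
  obtain rfl : inst = Classical.decEq V := Subsingleton.elim _ _
  exact @Equiv.swap_apply_def V (Classical.decEq V) a b x

theorem transp_left {V : Type} (a b : V) : transp a b a = b :=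
  @Equiv.swap_apply_left V (Classical.decEq V) a b

theorem transp_right {V : Type} (a b : V) : transp a b b = a :=
  @Equiv.swap_apply_right V (Classical.decEq V) a b

theorem transp_of_ne {V : Type} {a b x : V} (ha : x ≠ a) (hb : x ≠ b) : transp a b x = x :=
  @Equiv.swap_apply_of_ne_of_ne V (Classical.decEq V) a b x ha hb

theorem transp_mul_self {V : Type} (a b : V) : transp a b * transp a b = 1 :=
  @Equiv.swap_mul_self V (Classical.decEq V) a b

theorem insertAfter_self {V : Type} (σ : Equiv.Perm V) (v : V) :
    insertAfter σ v (some v) = none := by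
  simp [insertAfter, transp_left]

theorem insertAfter_none {V : Type} (σ : Equiv.Perm V) (v : V) :
    insertAfter σ v none = some (σ v) := by
  simp [insertAfter, transp_right]

theorem insertAfter_of_ne {V : Type} (σ : Equiv.Perm V) {v x : V} (h : x ≠ v) :
    insertAfter σ v (some x) = some (σ x) := by
  rw [insertAfter, Equiv.Perm.mul_apply, transp_of_ne (by simpa using h) (by simp)]
  simp

/-- Contraction of the first leg of a tensor with two legs with the leg `v`. -/
def gateEquiv {V : Type} [DecidableEq V] (v : V) : V ⊕ Fin 2 ≃ Option (Option V) where
  toFun := Sum.elim (fun x => if x = v then none else some (some x)) ![some none, some (some v)]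
  invFun o := o.elim (Sum.inl v) fun o => o.elim (Sum.inr 0)
    fun x => if x = v then Sum.inr 1 else Sum.inl x
  left_inv := by
    rintro (x | i)
    · by_cases h : x = v <;> simp [h]
    · fin_cases i <;> simp
  right_inv := by
    rintro (_ | _ | x)
    · simp
    · simp
    · by_cases h : x = v <;> simp [h]

/-- Contraction of the first leg of a tensor with three legs with the leg `v`. -/
def splitEquiv {V : Type} [DecidableEq V] (v : V) : V ⊕ Fin 3 ≃ Option (Option (Option V)) where
  toFun := Sum.elim (fun x => if x = v then none else some (some (some x)))
    ![some none, some (some (some v)), some (some none)]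
  invFun o := o.elim (Sum.inl v) fun o => o.elim (Sum.inr 0) fun o => o.elim (Sum.inr 2)
    fun x => if x = v then Sum.inr 1 else Sum.inl x
  left_inv := by
    rintro (x | i)
    · by_cases h : x = v <;> simp [h]
    · fin_cases i <;> simp
  right_inv := by
    rintro (_ | _ | _ | x)
    · simp
    · simp
    · simp
    · by_cases h : x = v <;> simp [h]

/-- The renaming that turns the legs `some none` and `some (some w)` into the legs to be contracted
and `none` into `w`. -/
def joinEquiv {V : Type} [DecidableEq V] (w : V) : Option (Option V) ≃ Option (Option V) :=
  (Equiv.swap none (some (some w))).trans (Equiv.swap none (some none))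

namespace Realizable

variable {V W : Type} {σ : Equiv.Perm V} {τ : Equiv.Perm W} {T : (V → Bool) → ℂ}
  {S : (W → Bool) → ℂ}

theorem congr (h : Realizable σ T) {T' : (V → Bool) → ℂ} (e : ∀ z, T' z = T z) :
    Realizable σ T' := by
  obtain rfl : T' = T := funext e
  exact h

theorem smul (h : Realizable σ T) {c : ℂ} (hc : c ≠ 0) : Realizable σ fun z => c * T z := by
  obtain ⟨M, hM, d, hd, hT⟩ := h
  exact ⟨M, hM, c * d, mul_ne_zero hc hd, fun x => by simp only [hT]; ring⟩

theorem node {n : ℕ} {T : (Fin n → Bool) → ℂ} (h : CliffordGenerator n T) :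
    Realizable (finRotate n) T :=
  ⟨.node n T, h, 1, one_ne_zero, fun x => by simp [PlanarTN.eval]⟩

theorem relabel (h : Realizable σ T) (e : V ≃ W) :
    Realizable (e.permCongr σ) fun z => T (z ∘ e) := by
  obtain ⟨M, hM, d, hd, hT⟩ := h
  exact ⟨.relabel e M, hM, d, hd, fun x => hT _⟩

theorem strip (h : Realizable σ T) {a b : V} (hab : a ≠ b) (hs : σ.SameCycle a b) :
    Realizable (σ * transp a b) T := by
  obtain ⟨M, hM, d, hd, hT⟩ := h
  exact ⟨.strip a b hab hs M, hM, d, hd, hT⟩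

theorem merge (hT : Realizable σ T) (hS : Realizable τ S) (a : V) (b : W) :
    Realizable (Equiv.sumCongr σ τ * transp (Sum.inl a) (Sum.inr b))
      fun z => T (z ∘ Sum.inl) * S (z ∘ Sum.inr) := by
  obtain ⟨M, hM, c, hc, hT⟩ := hT
  obtain ⟨N, hN, d, hd, hS⟩ := hS
  refine ⟨.merge a b M N, ⟨hM, hN⟩, c * d, mul_ne_zero hc hd, fun x => ?_⟩
  simp only [hT, hS, PlanarTN.eval]
  ring

/-- Contraction of two neighbouring legs. -/
theorem contract (h : Realizable σ T) (e : V ≃ Option (Option W))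
    (hpq : σ (e.symm none) = e.symm (some none)) {ρ : Equiv.Perm W}
    (h₁ : ∀ k, σ (e.symm (some (some k))) ≠ e.symm none →
      σ (e.symm (some (some k))) = e.symm (some (some (ρ k))))
    (h₂ : ∀ k, σ (e.symm (some (some k))) = e.symm none →
      σ (e.symm (some none)) = e.symm (some (some (ρ k)))) :
    Realizable ρ fun x => ∑ b : Bool, T fun u => (e u).elim b fun o => o.elim b x := by
  have h' := h.relabel e
  set σ' := e.permCongr σ with hσ'
  obtain ⟨M, hM, d, hd, hT⟩ := h'
  have hn : σ' none = some none := by simp [hσ', hpq]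
  have hc : σ'.SameCycle none (some none) := ⟨1, by simpa using hn⟩
  have hρ : Equiv.removeNone (Equiv.removeNone (σ' * transp none (some none))) = ρ := by
    set f := σ' * transp none (some none) with hf
    have f0 : f none = σ' (some none) := by simp [hf, transp_left]
    have f1 : f (some none) = some none := by simp [hf, transp_right, hn]
    have f2 : ∀ k, f (some (some k)) = σ' (some (some k)) := fun k => by
      rw [hf, Equiv.Perm.mul_apply, transp_of_ne (by simp) (by simp)]
    -- Removing the neighbouring pair reroutes the predecessor of its first leg to the successor of
    -- its second leg; all other arrows stay.
    have g : ∀ k, Equiv.removeNone f (some k) = some (ρ k) := fun k => by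
      apply Option.some_injective
      by_cases hk : σ (e.symm (some (some k))) = e.symm none
      · rw [Equiv.removeNone_none _ (by rw [f2]; simp [hσ', hk]), f0]
        simp [hσ', h₂ k hk]
      · have := h₁ k hk
        rw [Equiv.removeNone_some _ ⟨some (ρ k), by rw [f2]; simp [hσ', this]⟩, f2]
        simp [hσ', this]
    ext k
    apply Option.some_injective
    rw [Equiv.removeNone_some _ ⟨_, g k⟩, g]
  subst hρ
  refine ⟨.contract hc M, hM, d, hd, fun x => ?_⟩
  rw [PlanarTN.eval, Finset.mul_sum]
  exact Finset.sum_congr rfl fun b _ => hT fun o => o.elim b fun o' => o'.elim b x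

/-- Merging after `v` and after leg 1 of the matrix gives the order v, 0, 1, σ v. Contracting the
neighbours v and 0 leaves leg 1 in the place of v, so the layout is unchanged. -/
theorem gate [DecidableEq V] (h : Realizable σ T) (v : V) {A : Matrix Bool Bool ℂ}
    (hA : CliffordGenerator 2 (twoLeg A)) :
    Realizable σ fun z => ∑ b : Bool, A b (z v) * T (Function.update z v b) := by
  have h' := (h.merge (node hA) v 1).contract (gateEquiv v) (ρ := σ) ?_ ?_ ?_
  · refine h'.congr fun z => Finset.sum_congr rfl fun b _ => ?_
    rw [mul_comm]
    congr 2
    · funext x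
      by_cases hx : x = v <;> simp [gateEquiv, hx]
  · simp [gateEquiv, transp_left]
  · intro k
    by_cases hk : k = v
    · subst hk
      simp +contextual [gateEquiv, transp_right]
    · simp [gateEquiv, hk, transp_of_ne]
  · intro k
    by_cases hk : k = v
    · subst hk
      simp +contextual [gateEquiv, transp_right, transp_of_ne]
    · simp [gateEquiv, hk, transp_of_ne]

/-- A parity tensor is attached to the leg `v`, which is replaced by two neighbouring legs. -/
theorem split [DecidableEq V] (h : Realizable σ T) (v : V) :
    Realizable (insertAfter σ v) fun z : Option V → Bool =>
      T (Function.update (z ∘ some) v (xor (z (some v)) (z none))) := by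
  -- The order is v, 0, 1, 2, σ v; after contraction of v with 0, leg 1 inherits the name `v` and
  -- leg 2 is the inserted one.
  have h' := (h.merge (node .parity) v 2).contract (splitEquiv v) (ρ := insertAfter σ v) ?_ ?_ ?_
  · refine h'.congr fun z => ?_
    have key : ∀ b : Bool, (fun u => (splitEquiv v u).elim b fun o => o.elim b z) ∘ Sum.inl =
        Function.update (z ∘ some) v b := fun b => by
      funext x
      by_cases hx : x = v <;> simp [splitEquiv, hx]
    simp only [key, Fintype.sum_bool]
    cases h1 : z (some v) <;> cases h2 : z none <;> simp [parityTensor, splitEquiv, h1, h2]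
  · simp [splitEquiv, transp_left]
  · rintro (_ | k)
    · simp [splitEquiv, transp_right, insertAfter_none]
    · by_cases hk : k = v
      · subst hk
        simp [splitEquiv, insertAfter_self, transp_of_ne]
      · simp [splitEquiv, insertAfter_of_ne, hk, transp_of_ne]
  · rintro (_ | k)
    · simp [splitEquiv, transp_right, insertAfter_none, transp_of_ne]
    · by_cases hk : k = v
      · subst hk
        simp [splitEquiv, insertAfter_self, transp_of_ne]
      · simp [splitEquiv, insertAfter_of_ne, hk, transp_of_ne]

/-- e^{-iπZ/4} = cos(π/4)(1 - i) diag(1, i), so the phase gate is a generator up to a nonzero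
scalar. -/
theorem phase (h : Realizable σ T) (v : V) :
    Realizable σ fun z => (if z v then I else 1) * T z := by
  classical
  have hc : ((Real.cos (Real.pi / 4) : ℝ) : ℂ) ≠ 0 := by
    rw [Real.cos_pi_div_four]
    exact_mod_cast (by positivity : Real.sqrt 2 / 2 ≠ 0)
  have hI : (1 - I) ≠ 0 := fun h => by simpa using congrArg Complex.re h
  refine ((h.gate v .expZneg).smul (inv_ne_zero (mul_ne_zero hc hI))).congr fun z => ?_
  rw [inv_mul_eq_div, eq_div_iff (mul_ne_zero hc hI), Fintype.sum_bool]
  have hs : ((Real.sin (-(Real.pi / 4)) : ℝ) : ℂ) = -((Real.cos (Real.pi / 4) : ℝ) : ℂ) := by simp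
  have hc' : ((Real.cos (-(Real.pi / 4)) : ℝ) : ℂ) = ((Real.cos (Real.pi / 4) : ℝ) : ℂ) := by simp
  have hz : z = Function.update z v (z v) := (Function.update_eq_self v z).symm
  cases hv : z v <;> rw [hv] at hz <;>
    simp only [expI, pauliZ, Matrix.add_apply, Matrix.smul_apply, smul_eq_mul, hs, hc',
      Matrix.one_apply, ← hz] <;> simp [-Complex.ofReal_cos, -Real.cos_pi_div_four]
  · ring
  · linear_combination (-((Real.cos (Real.pi / 4) : ℝ) : ℂ) * T z) * I_mul_I

theorem hadamard [DecidableEq V] (h : Realizable σ T) (v : V) :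
    Realizable σ (hadamard v T) := by
  have hc : ((Real.cos (Real.pi / 4) : ℝ) : ℂ) ≠ 0 := by
    rw [Real.cos_pi_div_four]
    exact_mod_cast (by positivity : Real.sqrt 2 / 2 ≠ 0)
  refine ((((h.phase v).gate v .expXneg).smul (inv_ne_zero hc)).phase v).congr fun z => ?_
  rw [hadamard_eq_phase]
  congr 1
  rw [inv_mul_eq_div, eq_div_iff hc, Finset.sum_mul]
  refine Finset.sum_congr rfl fun b _ => ?_
  have hs : ((Real.sin (-(Real.pi / 4)) : ℝ) : ℂ) = -((Real.cos (Real.pi / 4) : ℝ) : ℂ) := by simp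
  have hc' : ((Real.cos (-(Real.pi / 4)) : ℝ) : ℂ) = ((Real.cos (Real.pi / 4) : ℝ) : ℂ) := by simp
  simp only [expI, pauliX, Matrix.add_apply, Matrix.smul_apply, smul_eq_mul, hs, hc',
      Matrix.one_apply]
  cases b <;> cases z v <;> simp <;> ring

/-- The leg `v` is replaced by two neighbouring copies. -/
theorem copy [DecidableEq V] (h : Realizable σ T) (v : V) :
    Realizable (insertAfter σ v) fun z : Option V → Bool =>
      if z none = z (some v) then T (z ∘ some) else 0 := by
  -- The copy tensor is the parity tensor with a Hadamard gate on each leg; the sums over the two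
  -- new legs contribute the factor 4.
  refine (((((h.hadamard v).split v).hadamard (some v)).hadamard none).smul
    (c := 1 / 4) (by norm_num)).congr fun z => ?_
  have key : ∀ a b : Bool, (Function.update (Function.update z none a) (some v) b) ∘ some =
      Function.update (z ∘ some) v b := fun a b => by
    funext x
    by_cases hx : x = v
    · subst hx; simp
    · simp [hx]
  have hz : z ∘ some = Function.update (z ∘ some) v (z (some v)) :=
    (Function.update_eq_self v (z ∘ some)).symm
  simp only [Quon.hadamard, key, Function.update_idem, Function.update_self, Fintype.sum_bool]
  cases h1 : z none <;> cases h2 : z (some v) <;> rw [h2] at hz <;> simp [h2, ← hz] <;> ring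

/-- Both legs are copied, and a Hadamard matrix (-1)^{ab} links a copy of v to a copy of σ v. The
order is v, copy of v, first and second copy of σ v, so the linked legs are neighbours, and the
second copy takes over the name σ v. -/
theorem controlledZ (h : Realizable σ T) {v : V} (hv : σ v ≠ v) :
    Realizable σ (controlledZ v (σ v) T) := by
  classical
  set w := σ v
  have hs1 : (joinEquiv w).symm none = some none := by
    simp [joinEquiv, Equiv.swap_apply_of_ne_of_ne]
  have hs2 : (joinEquiv w).symm (some none) = some (some w) := by simp [joinEquiv]
  have hs3 : (joinEquiv w).symm (some (some w)) = none := by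
    simp [joinEquiv, Equiv.swap_apply_of_ne_of_ne]
  have hs4 : ∀ x, x ≠ w → (joinEquiv w).symm (some (some x)) = some (some x) := fun x hx => by
    simp [joinEquiv, Equiv.swap_apply_of_ne_of_ne, hx]
  have h' := (((h.copy v).hadamard none).copy (some w)).contract (joinEquiv w) (ρ := σ) ?_ ?_ ?_
  · refine h'.congr fun z => ?_
    have k0 : joinEquiv w none = some (some w) := by rw [← hs3, Equiv.apply_symm_apply]
    have k1 : joinEquiv w (some none) = none := by rw [← hs1, Equiv.apply_symm_apply]
    have k2 : joinEquiv w (some (some w)) = some none := by rw [← hs2, Equiv.apply_symm_apply]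
    have k3 : ∀ x, x ≠ w → joinEquiv w (some (some x)) = some (some x) := fun x hx => by
      conv_lhs => rw [← hs4 x hx, Equiv.apply_symm_apply]
    have key : ∀ b c : Bool, Function.update ((fun u => (joinEquiv w u).elim b
        fun o => o.elim b z) ∘ some) none c ∘ some = Function.update z w b := fun b c => by
      funext x
      by_cases hx : x = w
      · subst hx; simp [k2]
      · simp [k3, hx]
    have hz : z = Function.update z w (z w) := (Function.update_eq_self w z).symm
    simp only [Quon.hadamard, Quon.controlledZ, key, Fintype.sum_bool]
    cases h1 : z w <;> cases h2 : z v <;> rw [h1] at hz <;>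
      simp [k0, k1, k2, k3 v hv.symm, h1, h2, ← hz]
  · rw [hs1, hs2, insertAfter_of_ne _ (by simp), insertAfter_none]
  · intro k hk
    by_cases hkw : k = w
    · subst hkw
      rw [hs3, insertAfter_none, insertAfter_of_ne _ hv, hs4]
      exact fun h => hv (σ.injective h)
    · rw [hs4 k hkw, insertAfter_of_ne _ (by simpa using hkw)] at hk ⊢
      by_cases hkv : k = v
      · subst hkv
        rw [insertAfter_self, hs1] at hk
        exact absurd rfl hk
      · rw [insertAfter_of_ne _ hkv, hs4]
        exact fun h => hkv (σ.injective h)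
  · intro k hk
    rw [hs1] at hk
    rw [hs2, insertAfter_self]
    by_cases hkw : k = w
    · subst hkw
      rw [hs3, insertAfter_none, insertAfter_of_ne _ hv] at hk
      simp at hk
    · rw [hs4 k hkw, insertAfter_of_ne _ (by simpa using hkw)] at hk
      by_cases hkv : k = v
      · subst hkv
        exact hs3.symm
      · rw [insertAfter_of_ne _ hkv] at hk
        simp at hk

/-- A parity tensor closed up on itself gives ∑_b S(b + b) = 2 S(0), a projection onto |0⟩; applied
to the Hadamard transform of T it sums over the leg. -/
theorem sum {σ : Equiv.Perm (Option V)} {T : (Option V → Bool) → ℂ} (h : Realizable σ T) :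
    Realizable (Equiv.removeNone σ) fun z => ∑ b : Bool, T fun o => o.elim b z := by
  classical
  have h' := ((h.hadamard none).split none).contract (Equiv.swap none (some none))
    (ρ := Equiv.removeNone σ) ?_ ?_ ?_
  · refine (h'.smul (c := 1 / 2) (by norm_num)).congr fun z => ?_
    have key : ∀ (b c : Bool) (w : Option (Option V) → Bool),
        (∀ x, w (some (some x)) = z x) → Function.update (Function.update (w ∘ some) none b) none c
            =
        fun o => o.elim c z := fun b c w hw => by
      funext o
      cases o <;> simp [hw]
    have hw : ∀ (b : Bool) x, (fun u => (Equiv.swap none (some none) u).elim b fun o => o.elim b z)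
        (some (some x)) = z x := fun b x => by
      simp [Equiv.swap_apply_of_ne_of_ne]
    simp only [Quon.hadamard, key _ _ (fun u => (Equiv.swap none (some none) u).elim _ fun o =>
        o.elim _ z) (hw _), Fintype.sum_bool]
    simp
    ring
  · simp [insertAfter_self]
  · intro k hk
    simp [Equiv.swap_apply_of_ne_of_ne, insertAfter_of_ne] at hk ⊢
    exact (Equiv.removeNone_some σ (Option.ne_none_iff_exists'.1 hk)).symm
  · intro k hk
    simp [Equiv.swap_apply_of_ne_of_ne, insertAfter_of_ne] at hk
    simp [Equiv.swap_apply_of_ne_of_ne, insertAfter_none]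
    exact (Equiv.removeNone_none σ hk).symm

end Realizable

/-! ### Networks in a disk, with all legs on one circle -/

theorem removeNone_finRotate (n : ℕ) :
    Equiv.removeNone ((finSuccEquiv n).permCongr (finRotate (n + 1))) = finRotate n := by
  rcases n with _ | n
  · exact Subsingleton.elim _ _
  ext k : 1
  apply Option.some_injective
  induction k using Fin.lastCases with
  | last =>
    rw [Equiv.removeNone_none]
    · rw [Equiv.permCongr_apply, finSuccEquiv_symm_none, finRotate_apply, finRotate_apply,
        Fin.last_add_one, zero_add, ← Fin.succ_zero_eq_one, finSuccEquiv_succ]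
    · simp [Equiv.permCongr_apply]
  | cast k =>
    have h : (finSuccEquiv (n + 1)).permCongr (finRotate (n + 1 + 1)) (some k.castSucc) =
        some k.succ := by
      rw [Equiv.permCongr_apply, finSuccEquiv_symm_some, Fin.succ_castSucc, finRotate_apply,
        Fin.coeSucc_eq_succ, finSuccEquiv_succ]
    rw [Equiv.removeNone_some _ ⟨_, h⟩, h, finRotate_apply, Fin.coeSucc_eq_succ]

theorem permCongr_insertAfter_last (n : ℕ) :
    (finSuccEquivLast (n := n + 1)).symm.permCongr (insertAfter (finRotate (n + 1)) (Fin.last n)) =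
      finRotate (n + 2) := by
  ext k : 1
  rw [Equiv.permCongr_apply, Equiv.symm_symm]
  induction k using Fin.lastCases with
  | last => simp [insertAfter_none]
  | cast k =>
    rw [finSuccEquivLast_castSucc]
    induction k using Fin.lastCases with
    | last => simp [insertAfter_self]
    | cast k =>
      rw [insertAfter_of_ne _ (Fin.castSucc_lt_last k).ne, finSuccEquivLast_symm_some,
        finRotate_apply, finRotate_apply, Fin.coeSucc_eq_succ, Fin.coeSucc_eq_succ,
        Fin.succ_castSucc]

namespace Realizable

theorem one_finRotate_one : Realizable (finRotate 1) fun _ => 1 :=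
  ((node .ketZero).hadamard 0).congr fun z => by simp [Quon.hadamard, ketZero]

theorem one_finRotate : ∀ n : ℕ, Realizable (finRotate n) fun _ => 1
  | 0 => by
    have h := (one_finRotate_one.relabel (finSuccEquiv 0)).sum
    rw [removeNone_finRotate] at h
    exact (h.smul (c := 1 / 2) (by norm_num)).congr fun z => by simp
  | 1 => one_finRotate_one
  | n + 2 => by
    -- A parity tensor attached to an all-one tensor yields the all-one tensor with one more leg.
    have h := ((one_finRotate (n + 1)).split (Fin.last n)).relabel finSuccEquivLast.symm
    rwa [permCongr_insertAfter_last] at h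

theorem cliffordClosed : CliffordClosed fun n T => Realizable (finRotate n) T where
  one := one_finRotate
  smul c hc h := h.smul hc
  phase i h := h.phase i
  hadamard i h := h.hadamard i
  controlledZ {n T} i h := by
    have hi : finRotate (n + 1) i.castSucc = i.succ := by simp
    have := h.controlledZ (v := i.castSucc) (by rw [hi]; exact (Fin.castSucc_lt_succ (i := i)).ne')
    rwa [hi] at this
  sum {n T} h := by
    have h := (h.relabel (finSuccEquiv n)).sum
    rw [removeNone_finRotate] at h
    refine h.congr fun z => Finset.sum_congr rfl fun b _ => congrArg T (funext fun i => ?_)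
    refine Fin.cases ?_ (fun i => ?_) i <;> simp

end Realizable

/-! ### From one circle to arbitrary layouts -/

/-- A transitive permutation is a single full cycle, and the cycle type determines the conjugacy
class. -/
theorem finRotate_isConj {n : ℕ} (τ : Equiv.Perm (Fin n)) (h : ∀ a b, τ.SameCycle a b) :
    ∃ π : Equiv.Perm (Fin n), π.permCongr (finRotate n) = τ := by
  by_cases hn : n ≤ 1
  · have : Subsingleton (Fin n) := Fin.subsingleton_iff_le_one.2 hn
    exact ⟨1, Subsingleton.elim _ _⟩
  obtain ⟨n, rfl⟩ : ∃ m, n = m + 2 := ⟨n - 2, by omega⟩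
  have hne : ∀ x, τ x ≠ x := fun x hx => by
    obtain ⟨y, hy⟩ := exists_ne x
    obtain ⟨k, hk⟩ := h x y
    rw [Equiv.Perm.zpow_apply_eq_self_of_apply_eq_self hx] at hk
    exact hy hk.symm
  have hc : τ.IsCycle := ⟨0, hne 0, fun y _ => h 0 y⟩
  have hs : τ.support = Finset.univ := Finset.eq_univ_of_forall fun x =>
    Equiv.Perm.mem_support.2 (hne x)
  have ht : (finRotate (n + 2)).cycleType = τ.cycleType := by
    rw [cycleType_finRotate, hc.cycleType, hs]
    simp
  obtain ⟨π, hπ⟩ := isConj_iff.1 (Equiv.Perm.isConj_iff_cycleType_eq.2 ht)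
  exact ⟨π, hπ⟩

/-- A transposition of points on different cycles merges the two cycles. This is the inverse of
cutting a circle by a strip. -/
theorem sameCycle_mul_transp {V : Type} [Finite V] {σ : Equiv.Perm V} {a b : V}
    (h : ¬ σ.SameCycle a b) :
    (σ * transp a b).SameCycle a b ∧
      ∀ x, σ.SameCycle a x → (σ * transp a b).SameCycle a x := by
  set τ := σ * transp a b with hτ
  have hb : τ b = σ a := by simp [hτ, transp_right]
  -- From b, the permutation τ enters the old cycle of a at σ a and follows it until it returns to
  -- a; finiteness of the order guarantees the return.
  have key : ∀ i : ℕ, τ.SameCycle b ((σ ^ (i + 1)) a) := by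
    intro i
    induction i with
    | zero => exact ⟨1, by simp [hb]⟩
    | succ i ih =>
      rw [pow_succ', Equiv.Perm.mul_apply]
      by_cases hi : (σ ^ (i + 1)) a = a
      · rw [hi, ← hb]
        exact ⟨1, by simp⟩
      · have hib : (σ ^ (i + 1)) a ≠ b := fun hib => h ⟨(i + 1 : ℕ), by rw [zpow_natCast, hib]⟩
        have : τ ((σ ^ (i + 1)) a) = σ ((σ ^ (i + 1)) a) := by
          rw [hτ, Equiv.Perm.mul_apply, transp_of_ne hi hib]
        rw [← this]
        exact Equiv.Perm.sameCycle_apply_right.2 ih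
  have hba : τ.SameCycle b a := by
    have hpos : 0 < orderOf σ := orderOf_pos σ
    have := key (orderOf σ - 1)
    rwa [Nat.sub_add_cancel hpos, pow_orderOf_eq_one] at this
  refine ⟨hba.symm, fun x hx => ?_⟩
  obtain ⟨i, hi⟩ := hx.exists_nat_pow_eq
  rcases i with _ | i
  · rw [pow_zero] at hi
    exact ⟨0, hi⟩
  · rw [← hi]
    exact hba.symm.trans (key i)

/-- Any tensor of the form `CliffordSum` is that of a planar Clifford network with any given layout:
arrange all legs on one circle, and then split it by strips. -/
theorem CliffordSum.realizable {V : Type} [Finite V] {T : (V → Bool) → ℂ} (hT : CliffordSum T)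
    (σ : Equiv.Perm V) : Realizable σ T := by
  have transitive : ∀ τ : Equiv.Perm V, (∀ a b, τ.SameCycle a b) → Realizable τ T := by
    intro τ hτ
    obtain ⟨n, ⟨e⟩⟩ := Finite.exists_equiv_fin V
    obtain ⟨π, hπ⟩ := finRotate_isConj (e.permCongr τ) fun a b => by
      obtain ⟨k, hk⟩ := hτ (e.symm a) (e.symm b)
      refine ⟨k, ?_⟩
      have : (e.permCongr τ) ^ k = e.permCongr (τ ^ k) := (map_zpow e.permCongrHom τ k).symm
      rw [this, Equiv.permCongr_apply, hk, Equiv.apply_symm_apply]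
    have h := (Realizable.cliffordClosed.of_cliffordSum hT (e.trans π.symm)).relabel
      (e.trans π.symm).symm
    have hτ' : (e.trans π.symm).symm.permCongr (finRotate n) = τ := by
      ext v
      have := congrArg (fun f => e.symm (f (e v))) hπ
      simpa [Equiv.permCongr_apply] using this
    rw [hτ'] at h
    refine h.congr fun z => congrArg T (funext fun v => ?_)
    simp
  rcases isEmpty_or_nonempty V with hV | ⟨⟨a⟩⟩
  · exact transitive σ fun a => hV.elim a
  -- Induction on the number of legs that are not on the boundary circle of `a`.
  suffices ∀ (k : ℕ) (τ : Equiv.Perm V), {x | ¬ τ.SameCycle a x}.ncard = k → Realizable τ T from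
    this _ σ rfl
  intro k
  induction k using Nat.strong_induction_on with
  | _ k ih =>
    intro τ hk
    by_cases hτ : ∀ x, τ.SameCycle a x
    · exact transitive τ fun x y => (hτ x).symm.trans (hτ y)
    · push Not at hτ
      obtain ⟨b, hb⟩ := hτ
      obtain ⟨h1, h2⟩ := sameCycle_mul_transp hb
      have hlt : {x | ¬ (τ * transp a b).SameCycle a x}.ncard < k := by
        rw [← hk]
        exact Set.ncard_lt_ncard ⟨fun x hx h => hx (h2 x h), fun h => h hb h1⟩ (Set.toFinite _)
      -- The layout with the circles of a and b merged is realizable by induction; the strip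
      -- multiplies by the same transposition again and restores τ.
      have h := (ih _ hlt _ rfl).strip (a := a) (b := b) (fun hab => hb (hab ▸ .refl τ a)) h1
      rwa [mul_assoc, transp_mul_self, mul_one] at h

theorem PlanarTN.finite {ι : Type} {σ : Equiv.Perm ι} (N : PlanarTN ι σ) : Finite ι := by
  induction N with
  | node n T => infer_instance
  | relabel e N ih => exact Finite.of_equiv _ e
  | merge a b N M ihN ihM => infer_instance
  | mergeBlank N M ihN ihM => infer_instance
  | strip a b hab h N ih => exact ih
  | contract h N ih =>
    exact Finite.of_injective (fun k => some (some k))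
      fun a b h => Option.some_injective _ (Option.some_injective _ h)

/-! ## Elementary pieces in the occupation basis -/

theorem fourthRootTwo_ne_zero : fourthRootTwo ≠ 0 := by
  unfold fourthRootTwo
  exact_mod_cast (Real.rpow_pos_of_pos two_pos _).ne'

theorem modify_append_cons (u r : List Bool) (a : Bool) :
    (u ++ a :: r).modify u.length not = u ++ (!a) :: r := by
  induction u with
  | nil => rfl
  | cons b u ih => simpa using ih

section Window

variable {q : ℕ} {u : List Bool} (ψ : Amp) (r : List Bool)

theorem capAt_even (hu : u.length = q) (a : Bool) :
    capAt (2 * q) ψ (u ++ a :: r) = if a then 0 else fourthRootTwo * ψ (u ++ r) := by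
  subst hu
  simp [capAt]

theorem capAt_odd (hu : u.length = q) (a b : Bool) :
    capAt (2 * q + 1) ψ (u ++ a :: b :: r) = fourthRootTwo⁻¹ * ψ (u ++ xor a b :: r) := by
  subst hu
  have h : (2 * u.length + 1) / 2 = u.length := by omega
  simp [capAt, h]

theorem cupAt_even (hu : u.length = q) :
    cupAt (2 * q) ψ (u ++ r) = fourthRootTwo * ψ (u ++ false :: r) := by
  subst hu
  simp [cupAt]

theorem cupAt_odd (hu : u.length = q) (a : Bool) :
    cupAt (2 * q + 1) ψ (u ++ a :: r) =
      fourthRootTwo⁻¹ * ∑ b : Bool, ψ (u ++ b :: xor b a :: r) := by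
  subst hu
  have h : (2 * u.length + 1) / 2 = u.length := by omega
  simp [cupAt, h]

theorem majorana_even (hu : u.length = q) (a : Bool) :
    majorana (2 * q) ψ (u ++ a :: r) = (-1) ^ u.count true * ψ (u ++ (!a) :: r) := by
  subst hu
  simp [majorana, modify_append_cons]

theorem majorana_odd (hu : u.length = q) (a : Bool) :
    majorana (2 * q + 1) ψ (u ++ a :: r) =
      I * (-1) ^ u.count true * (if a then -1 else 1) * ψ (u ++ (!a) :: r) := by
  subst hu
  have h : (2 * u.length + 1) / 2 = u.length := by omega
  have h' : (2 * u.length + 1) % 2 = 1 := by omega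
  cases a <;> simp [majorana, h, h', modify_append_cons, List.take_append, List.take_of_length_le,
      pow_succ]

theorem neg_one_pow_mul_self (n : ℕ) : (-1 : ℂ) ^ n * (-1) ^ n = 1 := by
  rw [← mul_pow]; simp

/-- Both strings belong to the mode q, and the Jordan–Wigner signs square away: the dot pair is Z on
this mode. -/
theorem dotPair_even (hu : u.length = q) (a : Bool) :
    dotPair (2 * q) (2 * q + 1) ψ (u ++ a :: r) = (if a then -1 else 1) * ψ (u ++ a :: r) := by
  simp only [dotPair, Pi.smul_apply, smul_eq_mul, majorana_even _ _ hu, majorana_odd _ _ hu]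
  have h := neg_one_pow_mul_self (u.count true)
  cases a <;> simp
  · linear_combination (I * I * ψ (u ++ false :: r)) * (-h) - ψ (u ++ false :: r) * I_mul_I
  · linear_combination (I * I * ψ (u ++ true :: r)) * h + ψ (u ++ true :: r) * I_mul_I

/-- The strings belong to adjacent modes, and the common Jordan–Wigner prefix cancels: the dot pair
is X ⊗ X. -/
theorem dotPair_odd (hu : u.length = q) (a b : Bool) :
    dotPair (2 * q + 1) (2 * q + 2) ψ (u ++ a :: b :: r) = ψ (u ++ (!a) :: (!b) :: r) := by
  have h2 : ∀ c : Bool, u ++ c :: b :: r = (u ++ [c]) ++ b :: r := by simp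
  have h3 : ∀ c : Bool, (u ++ [c]).length = q + 1 := by simp [hu]
  have e := majorana_even (q := q + 1) ψ r (h3 (!a)) b
  rw [Nat.mul_add, mul_one] at e
  simp only [dotPair, Pi.smul_apply, smul_eq_mul, majorana_odd _ _ hu]
  rw [h2, e]
  have h := neg_one_pow_mul_self (u.count true)
  cases a <;> simp [pow_succ]
  · linear_combination (-I * I * ψ (u ++ true :: (!b) :: r)) * h - ψ (u ++ true :: (!b) :: r) *
      I_mul_I
  · linear_combination (-I * I * ψ (u ++ false :: (!b) :: r)) * h - ψ (u ++ false :: (!b) :: r) *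
      I_mul_I

/-- The nonzero prefactor of a braid. -/
noncomputable def braidCoeff (positive : Bool) : ℂ :=
  if positive then exp (-(I * (Real.pi / 8))) / (Real.sqrt 2 : ℂ)
  else exp (I * (Real.pi / 8)) / (Real.sqrt 2 : ℂ)

theorem braidCoeff_ne_zero (positive : Bool) : braidCoeff positive ≠ 0 := by
  have h : ((Real.sqrt 2 : ℝ) : ℂ) ≠ 0 := by exact_mod_cast (by positivity : Real.sqrt 2 ≠ 0)
  cases positive <;> simp [braidCoeff]

theorem braidAt_eq (positive : Bool) (k : ℕ) (p : List Bool) :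
    braidAt positive k ψ p = braidCoeff positive *
      (ψ p + (if positive then I else -I) * dotPair k (k + 1) ψ p) := by
  cases positive <;> simp [braidAt, braidCoeff]
  ring

theorem scatterVert_eq (θ : ℂ) (k : ℕ) (p : List Bool) :
    scatterVert θ k ψ p = (1 + exp (I * θ)) / 2 * ψ p + (1 - exp (I * θ)) / 2 *
      dotPair k (k + 1) ψ p := rfl

/-- Compared with the vertical element, parities exchange roles: the coefficients (1 ± e^{iθ})/2 now
appear in the diagonal case and 1, e^{iθ} in the flip case. -/
theorem scatterHoriz_even (θ : ℂ) (hu : u.length = q) (a : Bool) :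
    scatterHoriz θ (2 * q) ψ (u ++ a :: r) = fourthRootTwo ^ 2 *
      (if a then (1 - exp (I * θ)) / 2 else (1 + exp (I * θ)) / 2) * ψ (u ++ a :: r) := by
  have h := neg_one_pow_mul_self (u.count true)
  simp only [scatterHoriz, Pi.add_apply, Pi.smul_apply, smul_eq_mul, majorana_odd _ _ hu,
    capAt_even _ _ hu, cupAt_even _ _ hu]
  cases a <;> simp
  · ring
  · linear_combination (-(1 - exp (I * θ)) / 2 * fourthRootTwo ^ 2 * ψ (u ++ true :: r)) * (I * I *
      h + I_mul_I)

theorem scatterHoriz_odd (θ : ℂ) (hu : u.length = q) (a b : Bool) :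
    scatterHoriz θ (2 * q + 1) ψ (u ++ a :: b :: r) = fourthRootTwo⁻¹ ^ 2 *
      (ψ (u ++ a :: b :: r) + exp (I * θ) * ψ (u ++ (!a) :: (!b) :: r)) := by
  have h := neg_one_pow_mul_self (u.count true)
  have h2 : ∀ c d : Bool, u ++ c :: d :: r = (u ++ [c]) ++ d :: r := by simp
  have h3 : ∀ c : Bool, (u ++ [c]).length = q + 1 := by simp [hu]
  have e : ∀ (φ : Amp) c d, majorana (2 * q + 1 + 1) φ (u ++ c :: d :: r) =
      (-1) ^ u.count true * (if c then -1 else 1) * φ (u ++ c :: (!d) :: r) := fun φ c d => by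
    rw [h2, show 2 * q + 1 + 1 = 2 * (q + 1) by ring, majorana_even (q := q + 1) φ r (h3 c) d]
    cases c <;> simp [pow_succ]
  simp only [scatterHoriz, Pi.add_apply, Pi.smul_apply, smul_eq_mul, e,
    capAt_odd _ _ hu, cupAt_odd _ _ hu, Fintype.sum_bool]
  cases a <;> cases b <;> simp
  · linear_combination ((1 - exp (I * θ)) / 2 * fourthRootTwo⁻¹ ^ 2 *
      (ψ (u ++ false :: false :: r) - ψ (u ++ true :: true :: r))) * h
  · linear_combination ((1 - exp (I * θ)) / 2 * fourthRootTwo⁻¹ ^ 2 *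
      (ψ (u ++ false :: true :: r) - ψ (u ++ true :: false :: r))) * h
  · linear_combination ((1 - exp (I * θ)) / 2 * fourthRootTwo⁻¹ ^ 2 *
      (ψ (u ++ true :: false :: r) - ψ (u ++ false :: true :: r))) * h
  · linear_combination ((1 - exp (I * θ)) / 2 * fourthRootTwo⁻¹ ^ 2 * (ψ (u ++ true :: true :: r) -
      ψ (u ++ false :: false :: r))) * h

/-- The normalizations of the nested caps cancel and leave an unnormalized Bell pair of modes; the
dots add the sign (-1)^{jb}. The encoder therefore uses the Hadamard dual of the code |a⟩ ↦ |aa⟩. -/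
theorem encoderKet_eq (j : Bool) (hu : u.length = q) (a b : Bool) :
    encoderKet j (2 * q) ψ (u ++ a :: b :: r) =
      (if j && b then -1 else 1) * if a = b then ψ (u ++ r) else 0 := by
  have h2 : ∀ c d : Bool, u ++ c :: d :: r = (u ++ [c]) ++ d :: r := by simp
  have hc : capAt (2 * q + 1) (capAt (2 * q) ψ) (u ++ a :: b :: r) =
      if a = b then ψ (u ++ r) else 0 := by
    rw [capAt_odd _ _ hu, capAt_even _ _ hu]
    have := fourthRootTwo_ne_zero
    cases a <;> cases b <;> simp [this]
  unfold encoderKet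
  cases j
  · simpa using hc
  · have h3 : (u ++ [a]).length = q + 1 := by simp [hu]
    have := dotPair_even (q := q + 1) (capAt (2 * q + 1) (capAt (2 * q) ψ)) r h3 b
    rw [← h2, hc, mul_add, mul_one] at this
    simpa using this

theorem encoderBra_eq (j : Bool) (hu : u.length = q) :
    encoderBra j (2 * q) ψ (u ++ r) =
      ∑ b : Bool, (if j && b then -1 else 1) * ψ (u ++ b :: b :: r) := by
  have h2 : ∀ c d : Bool, u ++ c :: d :: r = (u ++ [c]) ++ d :: r := by simp
  have h3 : ∀ c : Bool, (u ++ [c]).length = q + 1 := by simp [hu]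
  have hd : ∀ b c : Bool, dotPair (2 * q + 2) (2 * q + 3) ψ (u ++ b :: c :: r) =
      (if c then -1 else 1) * ψ (u ++ b :: c :: r) := fun b c => by
    have := dotPair_even (q := q + 1) ψ r (h3 b) c
    rwa [← h2] at this
  unfold encoderBra
  rw [cupAt_even _ _ hu, cupAt_odd _ _ hu, ← mul_assoc, mul_inv_cancel₀ fourthRootTwo_ne_zero]
  cases j <;> simp [hd]

theorem evenProj_eq (m : ℕ) (hu : u.length = q) (w : List Bool) (hw : w.length = m) :
    evenProj q m ψ (u ++ w ++ r) = if Even (w.count true) then ψ (u ++ w ++ r) else 0 := by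
  subst hu hw
  simp [evenProj]

end Window

/-! ### Amplitudes of nongeneric diagrams are Clifford sums -/

/-- The first `n` bits of a sequence. -/
def bits (n : ℕ) (w : ℕ → Bool) : List Bool := (List.range n).map w

theorem bits_length (n : ℕ) (w : ℕ → Bool) : (bits n w).length = n := by simp [bits]

theorem bits_add (a b : ℕ) (w : ℕ → Bool) :
    bits (a + b) w = bits a w ++ bits b fun i => w (a + i) := by
  simp [bits, List.range_add, Function.comp_def]

theorem bits_succ (n : ℕ) (w : ℕ → Bool) : bits (n + 1) w = w 0 :: bits n fun i => w (i + 1) := by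
  simp [bits, List.range_succ_eq_map, Function.comp_def]

theorem bits_congr {n : ℕ} {w w' : ℕ → Bool} (h : ∀ i < n, w i = w' i) : bits n w = bits n w' :=
  List.map_congr_left fun i hi => h i (List.mem_range.1 hi)

theorem bits_add_succ (q m : ℕ) (w : ℕ → Bool) :
    bits (q + (m + 1)) w = bits q w ++ w q :: bits m fun i => w (q + (i + 1)) := by
  rw [bits_add, bits_succ]
  rfl

theorem bits_add_two (q m : ℕ) (w : ℕ → Bool) :
    bits (q + (m + 2)) w =
      bits q w ++ w q :: w (q + 1) :: bits m fun i => w (q + (i + 2)) := by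
  rw [bits_add_succ, bits_succ]

theorem append_cons_congr {α : Type} {u u' r r' : List α} {a a' : α} (hu : u = u') (ha : a = a')
    (hr : r = r') : u ++ a :: r = u' ++ a' :: r' := by
  rw [hu, ha, hr]

variable {ι : Type}

/-- A family of amplitudes on `n` modes is of the form `CliffordSum` in the values of the tensor legs
and in the occupation numbers. -/
def CliffordAmp (n : ℕ) (ψ : (ι → Bool) → Amp) : Prop :=
  CliffordSum fun z : ι ⊕ ℕ → Bool => ψ (z ∘ Sum.inl) (bits n (z ∘ Sum.inr))

theorem update_inr_comp_inl [DecidableEq (ι ⊕ ℕ)] (z : ι ⊕ ℕ → Bool) (q : ℕ) (b : Bool) :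
    Function.update z (Sum.inr q) b ∘ Sum.inl = z ∘ Sum.inl := by
  funext x
  simp

theorem update_inr_comp_inr [DecidableEq (ι ⊕ ℕ)] (z : ι ⊕ ℕ → Bool) (q : ℕ) (b : Bool) :
    Function.update z (Sum.inr q) b ∘ Sum.inr = Function.update (z ∘ Sum.inr) q b := by
  funext x
  by_cases h : x = q
  · subst h; simp
  · simp [h]

/-- Two opposite flips, with coefficients `α` (no flip) and `β` (flip). -/
theorem CliffordSum.flip_two {V : Type} [DecidableEq V] {T : (V → Bool) → ℂ} (h : CliffordSum T)
    {a b : V} (hab : a ≠ b) {α β : ℂ}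
    (hc : CliffordSum fun z : Option V → Bool => if z none then β else α) :
    CliffordSum fun z => α * T z + β *
      T (Function.update (Function.update z a (!z a)) b (!z b)) := by
  have h1 := ((h.pullback some).update_xor (some b) (some b) none).update_xor (some a) (some a) none
  refine (hc.mul h1).sum.congr fun z => ?_
  have key : ∀ c : Bool, Function.update (Function.update (fun o : Option V => o.elim c z) (some a)
      (xor (z a) c)) (some b) (xor (z b) c) ∘ some =
      Function.update (Function.update z a (xor (z a) c)) b (xor (z b) c) := fun c => by
    funext x
    by_cases hb : x = b
    · subst hb; simp
    · by_cases ha : x = a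
      · subst ha; simp [hb]
      · simp [ha, hb]
  have hba : (some b : Option V) ≠ some a := fun e => hab (Option.some_injective _ e).symm
  simp only [Fintype.sum_bool, Option.elim_none, Option.elim_some,
    Function.update_of_ne (show (none : Option V) ≠ some a by simp), Function.update_of_ne hba, key]
  simp [add_comm]

namespace CliffordAmp

variable {n k q m : ℕ} {ψ : (ι → Bool) → Amp}

theorem capAt (h : CliffordAmp n ψ) (hk : k ≤ 2 * n) :
    CliffordAmp (n + 1) fun x => capAt k (ψ x) := by
  classical
  rcases Nat.even_or_odd' k with ⟨q, rfl | rfl⟩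
  · obtain ⟨m, rfl⟩ := Nat.exists_eq_add_of_le (show q ≤ n by omega)
    refine ((CliffordSum.ite_zero_one (Sum.inr q)).mul ((h.pullback (Sum.map id
      fun i => if i < q then i else i + 1)).const_mul fourthRootTwo)).congr fun z => ?_
    beta_reduce
    rw [add_assoc, bits_add_succ, capAt_even _ _ (bits_length _ _)]
    have e : bits (q + m) ((z ∘ Sum.map id fun i => if i < q then i else i + 1) ∘ Sum.inr) =
        bits q (z ∘ Sum.inr) ++ bits m fun i => (z ∘ Sum.inr) (q + (i + 1)) := by
      rw [bits_add]
      congr 1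
      · exact bits_congr fun i hi => by simp [hi]
      · exact bits_congr fun i hi => by simp [add_assoc]
    have e' : (z ∘ Sum.map id fun i => if i < q then i else i + 1) ∘ Sum.inl = z ∘ Sum.inl := rfl
    rw [e, e']
    by_cases hz : z (Sum.inr q) <;> simp [hz]
  · obtain ⟨m, rfl⟩ := Nat.exists_eq_add_of_le (show q + 1 ≤ n by omega)
    refine (((h.pullback (Sum.map id fun i => if i ≤ q then i else i + 1)).update_xor
      (Sum.inr q) (Sum.inr q) (Sum.inr (q + 1))).const_mul fourthRootTwo⁻¹).congr fun z => ?_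
    beta_reduce
    rw [show q + 1 + m + 1 = q + (m + 2) by ring, bits_add_two, capAt_odd _ _ (bits_length _ _)]
    congr 2
    · rw [show q + 1 + m = q + (m + 1) by ring, bits_add_succ]
      congr 1
      · refine bits_congr fun i hi => ?_
        simp [hi.le, hi.ne]
      congr 1
      · simp
      · refine bits_congr fun i hi => ?_
        simp [add_assoc]

theorem cupAt (h : CliffordAmp (n + 1) ψ) (hk : k ≤ 2 * n) :
    CliffordAmp n fun x => cupAt k (ψ x) := by
  classical
  rcases Nat.even_or_odd' k with ⟨q, rfl | rfl⟩
  · obtain ⟨m, rfl⟩ := Nat.exists_eq_add_of_le (show q ≤ n by omega)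
    refine (((h.update_const (Sum.inr q) false).pullback (Sum.map id
      fun i => if i < q then i else i - 1)).const_mul fourthRootTwo).congr fun z => ?_
    beta_reduce
    rw [bits_add, cupAt_even _ _ (bits_length _ _), update_inr_comp_inl, update_inr_comp_inr,
      add_assoc, bits_add_succ]
    refine congrArg _ (congrArg (ψ (z ∘ Sum.inl)) (append_cons_congr ?_ ?_ ?_))
    · refine bits_congr fun i hi => ?_
      simp [hi.ne, hi]
    · simp
    · refine bits_congr fun i hi => ?_
      simp [show ¬ q + (i + 1) < q by omega, show q + (i + 1) - 1 = q + i by omega]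
  · obtain ⟨m, rfl⟩ := Nat.exists_eq_add_of_le (show q + 1 ≤ n by omega)
    -- The annihilated pair merges the modes q and q + 1: the fresh variable `none` is the old bit
    -- q, and the remaining bit q is its sum with the old bit q + 1. Later modes move down by one.
    refine (((h.update_xor (Sum.inr (q + 1)) (Sum.inr q) (Sum.inr (q + 1))).pullback
      (W := Option (ι ⊕ ℕ)) (Sum.elim (fun ℓ => some (Sum.inl ℓ))
        fun i => if i < q then some (Sum.inr i) else if i = q then none else
          some (Sum.inr (i - 1)))).sum.const_mul fourthRootTwo⁻¹).congr fun z => ?_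
    beta_reduce
    rw [show q + 1 + m = q + (m + 1) by ring, bits_add_succ, cupAt_odd _ _ (bits_length _ _)]
    refine congrArg _ (Finset.sum_congr rfl fun b _ => ?_)
    rw [update_inr_comp_inl, update_inr_comp_inr, show q + (m + 1) + 1 = q + (m + 2) by ring,
      bits_add_two]
    refine congrArg (ψ (z ∘ Sum.inl)) (append_cons_congr ?_ ?_ (congrArg₂ _ ?_ ?_))
    · refine bits_congr fun i hi => ?_
      simp [hi, show i ≠ q + 1 by omega]
    · simp
    · simp
    · refine bits_congr fun i hi => ?_
      simp [show ¬ q + (i + 2) < q by omega, show q + (i + 2) - 1 = q + (i + 1) by omega]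

/-- The Jordan–Wigner sign of a dot: a product of signs of single modes. -/
theorem sign_count (t : ℕ) :
    CliffordSum fun z : ι ⊕ ℕ → Bool => (-1) ^ (bits t (z ∘ Sum.inr)).count true := by
  induction t with
  | zero => exact (CliffordSum.const 1).congr fun z => by simp [bits]
  | succ t ih =>
    refine (ih.mul (CliffordSum.sign_self (Sum.inr t))).congr fun z => ?_
    rw [bits_add]
    cases h : z (Sum.inr t) <;> simp [bits, pow_succ, h]

theorem majorana (h : CliffordAmp n ψ) (hk : k < 2 * n) :
    CliffordAmp n fun x => majorana k (ψ x) := by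
  classical
  rcases Nat.even_or_odd' k with ⟨q, hq⟩
  obtain ⟨m, rfl⟩ := Nat.exists_eq_add_of_le (show q + 1 ≤ n by omega)
  have h' := (sign_count (ι := ι) q).mul (h.update_not (Sum.inr q) (Sum.inr q))
  have key : ∀ z : ι ⊕ ℕ → Bool,
      ψ (Function.update z (Sum.inr q) (!z (Sum.inr q)) ∘ Sum.inl)
        (bits (q + 1 + m) (Function.update z (Sum.inr q) (!z (Sum.inr q)) ∘ Sum.inr)) =
      ψ (z ∘ Sum.inl) (bits q (z ∘ Sum.inr) ++ (!z (Sum.inr q)) ::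
        bits m fun i => (z ∘ Sum.inr) (q + (i + 1))) := fun z => by
    rw [update_inr_comp_inl, update_inr_comp_inr, show q + 1 + m = q + (m + 1) by ring,
      bits_add_succ]
    congr 2
    · refine bits_congr fun i hi => ?_
      simp [hi.ne]
    congr 1
    · simp
    · refine bits_congr fun i hi => ?_
      simp
  rcases hq with rfl | rfl
  · refine h'.congr fun z => ?_
    beta_reduce
    rw [key, show q + 1 + m = q + (m + 1) by ring, bits_add_succ,
        majorana_even _ _ (bits_length _ _)]
    rfl
  · refine ((h'.mul (CliffordSum.sign_self (Sum.inr q))).const_mul I).congr fun z => ?_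
    beta_reduce
    rw [key, show q + 1 + m = q + (m + 1) by ring, bits_add_succ,
        majorana_odd _ _ (bits_length _ _)]
    simp only [Function.comp]
    ring

theorem dotPair {a b : ℕ} (h : CliffordAmp n ψ) (ha : a < 2 * n) (hb : b < 2 * n) :
    CliffordAmp n fun x => dotPair a b (ψ x) :=
  ((h.majorana hb).majorana ha).const_mul I

/-- A diagonal operator on the mode `q`. -/
theorem diagonal (h : CliffordAmp n ψ) {c : Bool → ℂ}
    (hc : CliffordSum fun z : ι ⊕ ℕ → Bool => c (z (Sum.inr q))) (hq : q < n)
    {φ : (ι → Bool) → Amp}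
    (hφ : ∀ x u a r, u.length = q → φ x (u ++ a :: r) = c a * ψ x (u ++ a :: r)) :
    CliffordAmp n φ := by
  refine (hc.mul h).congr fun z => ?_
  obtain ⟨m, rfl⟩ := Nat.exists_eq_add_of_le (show q + 1 ≤ n by omega)
  rw [show q + 1 + m = q + (m + 1) by ring, bits_add_succ, hφ _ _ _ _ (bits_length _ _)]
  rfl

/-- An operator that is a combination of the identity and of the simultaneous flip of the modes `q`
and `q + 1`. -/
theorem flip (h : CliffordAmp n ψ) {α β : ℂ}
    (hc : CliffordSum fun z : Option (ι ⊕ ℕ) → Bool => if z none then β else α) (hq : q + 1 < n)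
    {φ : (ι → Bool) → Amp}
    (hφ : ∀ x u a b r, u.length = q → φ x (u ++ a :: b :: r) =
      α * ψ x (u ++ a :: b :: r) + β * ψ x (u ++ (!a) :: (!b) :: r)) :
    CliffordAmp n φ := by
  classical
  refine (CliffordSum.flip_two h (a := Sum.inr q) (b := Sum.inr (q + 1)) (by simp) hc).congr
    fun z => ?_
  obtain ⟨m, rfl⟩ := Nat.exists_eq_add_of_le (show q + 2 ≤ n by omega)
  simp only [update_inr_comp_inl, update_inr_comp_inr]
  rw [show q + 2 + m = q + (m + 2) by ring, bits_add_two, hφ _ _ _ _ _ (bits_length _ _),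
    bits_add_two]
  congr 4
  · refine bits_congr fun i hi => ?_
    simp [hi.ne, show i ≠ q + 1 by omega]
  congr 1
  · simp
  congr 1
  · simp
  · refine bits_congr fun i hi => ?_
    simp

end CliffordAmp

namespace CliffordAmp

variable {n k q m : ℕ} {ψ : (ι → Bool) → Amp}

/-- The average over the control bit is the parity projection (1 + P)/2. -/
theorem controlled_sign_count (q m : ℕ) :
    CliffordSum fun z : Option (ι ⊕ ℕ) → Bool =>
      if z none then (-1) ^ (bits m fun i => z (some (Sum.inr (q + i)))).count true else 1 := by
  induction m with
  | zero => exact (CliffordSum.const 1).congr fun z => by simp [bits]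
  | succ m ih =>
    refine (ih.mul (CliffordSum.sign none (some (Sum.inr (q + m))))).congr fun z => ?_
    rw [bits_add]
    cases h : z (some (Sum.inr (q + m))) <;> cases h' : z none <;> simp [bits, pow_succ, h]

theorem evenProj (h : CliffordAmp n ψ) (hq : q + m ≤ n) :
    CliffordAmp n fun x => evenProj q m (ψ x) := by
  obtain ⟨r, rfl⟩ := Nat.exists_eq_add_of_le hq
  refine (((controlled_sign_count q m).sum.const_mul (1 / 2)).mul h).congr fun z => ?_
  beta_reduce
  rw [bits_add, bits_add, evenProj_eq _ _ _ (bits_length _ _) _ (bits_length _ _)]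
  simp only [Fintype.sum_bool, Option.elim_none, Option.elim_some, Function.comp]
  set c := (bits m fun i => z (Sum.inr (q + i))).count true
  rcases Nat.even_or_odd c with hc | hc
  · simp [hc, hc.neg_one_pow]
    norm_num
  · simp [Nat.not_even_iff_odd.2 hc, hc.neg_one_pow]

theorem encoderKet (h : CliffordAmp n ψ) (hq : q ≤ n) (ℓ : ι) :
    CliffordAmp (n + 2) fun x => encoderKet (x ℓ) (2 * q) (ψ x) := by
  obtain ⟨m, rfl⟩ := Nat.exists_eq_add_of_le hq
  refine ((CliffordSum.sign (Sum.inl ℓ) (Sum.inr (q + 1))).mul ((CliffordSum.delta (Sum.inr q)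
    (Sum.inr (q + 1))).mul (h.pullback (Sum.map id fun i => if i < q then i else i + 2)))).congr
    fun z => ?_
  beta_reduce
  rw [add_assoc, bits_add_two, encoderKet_eq _ _ _ (bits_length _ _)]
  have e : bits (q + m) ((z ∘ Sum.map id fun i => if i < q then i else i + 2) ∘ Sum.inr) =
      bits q (z ∘ Sum.inr) ++ bits m fun i => (z ∘ Sum.inr) (q + (i + 2)) := by
    rw [bits_add]
    congr 1
    · exact bits_congr fun i hi => by simp [hi]
    · exact bits_congr fun i hi => by simp [add_assoc]
  have e' : (z ∘ Sum.map id fun i => if i < q then i else i + 2) ∘ Sum.inl = z ∘ Sum.inl := rfl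
  rw [e, e']
  cases h1 : z (Sum.inr q) <;> cases h2 : z (Sum.inr (q + 1)) <;> simp [h1, h2]

theorem encoderBra (h : CliffordAmp (n + 2) ψ) (hq : q ≤ n) (ℓ : ι) :
    CliffordAmp n fun x => encoderBra (x ℓ) (2 * q) (ψ x) := by
  obtain ⟨m, rfl⟩ := Nat.exists_eq_add_of_le hq
  refine ((CliffordSum.sign (some (Sum.inl ℓ)) none).mul (h.pullback
      (W := Option (ι ⊕ ℕ)) (Sum.elim (fun ℓ => some (Sum.inl ℓ))
        fun i => if i < q then some (Sum.inr i) else if i < q + 2 then none else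
          some (Sum.inr (i - 2))))).sum.congr fun z => ?_
  beta_reduce
  rw [bits_add, encoderBra_eq _ _ _ (bits_length _ _)]
  refine Finset.sum_congr rfl fun b _ => congrArg _ ?_
  rw [add_assoc, bits_add_two]
  refine congrArg (ψ (z ∘ Sum.inl)) (append_cons_congr ?_ ?_ (congrArg₂ _ ?_ ?_))
  · exact bits_congr fun i hi => by simp [hi]
  · simp
  · simp
  · refine bits_congr fun i hi => ?_
    simp [show ¬ q + (i + 2) < q by omega, show ¬ q + (i + 2) < q + 2 by omega,
      show q + (i + 2) - 2 = q + i by omega]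

theorem ite_coeff (c : Bool → ℂ) (t : ℂ) (j : ℕ) (h0 : c false = t) (h1 : c true = t * I ^ j)
    {V : Type} (v : V) : CliffordSum fun z : V → Bool => c (z v) :=
  ((CliffordSum.ite_I_pow v j).const_mul t).congr fun z => by
    cases z v <;> simp [h0, h1]

theorem ite_of_eq_mul {α β : ℂ} (j : ℕ) (h : β = α * I ^ j) {V : Type} (v : V) :
    CliffordSum fun z : V → Bool => if z v then β else α :=
  ite_coeff (fun a => if a then β else α) α j rfl h v

/-- In the diagonal case the eigenvalues 1 ± i have ratio a power of i; in the flip case the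
coefficients are 1 and ±i up to a common factor. -/
theorem braidAt (h : CliffordAmp n ψ) (hk : k + 2 ≤ 2 * n) (positive : Bool) :
    CliffordAmp n fun x => braidAt positive k (ψ x) := by
  rcases Nat.even_or_odd' k with ⟨q, rfl | rfl⟩
  · refine h.diagonal (q := q) (c := fun a => braidCoeff positive *
      (1 + (if positive then I else -I) * if a then -1 else 1)) ?_ (by omega) ?_
    · cases positive
      · refine ite_coeff (fun a => braidCoeff false * (1 + (if false then I else -I) *
          if a then -1 else 1)) (braidCoeff false * (1 + -I)) 1 ?_ ?_ (Sum.inr q) <;> simp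
        linear_combination braidCoeff false * I_mul_I
      · refine ite_coeff (fun a => braidCoeff true * (1 + (if true then I else -I) *
          if a then -1 else 1)) (braidCoeff true * (1 + I)) 3 ?_ ?_ (Sum.inr q) <;> simp [pow_succ]
        linear_combination braidCoeff true * I_mul_I
    · intro x u a r hu
      rw [braidAt_eq, dotPair_even _ _ hu]
      ring
  · refine h.flip (q := q) (α := braidCoeff positive)
      (β := braidCoeff positive * if positive then I else -I) ?_ (by omega) ?_
    · cases positive
      · refine ite_of_eq_mul 3 ?_ none
        simp [pow_succ]
      · refine ite_of_eq_mul 1 ?_ none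
        simp
    · intro x u a b r hu
      rw [braidAt_eq, dotPair_odd _ _ hu]
      ring

/-- The restriction on the scattering angles enters only through this identity. -/
theorem exp_eq_I_pow {θ : ℂ} (hθ : ∃ k : ℤ, θ = k * (Real.pi / 2)) :
    ∃ j : ℕ, j < 4 ∧ exp (Complex.I * θ) = I ^ j := by
  obtain ⟨k, rfl⟩ := hθ
  have h : exp (I * (k * (Real.pi / 2))) = I ^ k := by
    rw [show I * (k * (Real.pi / 2)) = k * (Real.pi / 2 * I) by ring, exp_int_mul,
      exp_pi_div_two_mul_I]
  refine ⟨(k % 4).toNat, by omega, ?_⟩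
  rw [h, ← zpow_natCast, Int.toNat_of_nonneg (by omega)]
  conv_lhs => rw [← Int.emod_add_mul_ediv k 4, zpow_add₀ I_ne_zero, zpow_mul]
  have : I ^ (4 : ℤ) = 1 := by exact_mod_cast I_pow_four
  simp [this]

/-- The coefficients of a nongeneric scattering element. -/
theorem scatter_coeff {V : Type} (v : V) {θ : ℂ} (hθ : ∃ k : ℤ, θ = k * (Real.pi / 2)) :
    CliffordSum fun z : V → Bool =>
      if z v then (1 - exp (I * θ)) / 2 else (1 + exp (I * θ)) / 2 := by
  obtain ⟨j, hj, hθ⟩ := exp_eq_I_pow hθ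
  rw [hθ]
  interval_cases j
  -- For e^{iθ} = ±1 one coefficient vanishes and an indicator is needed; for e^{iθ} = ±i the ratio
  -- of the coefficients is ∓i.
  · exact (CliffordSum.ite_zero_one v).congr fun z => by simp
  · refine ite_of_eq_mul 3 ?_ v
    simp [pow_succ]
    linear_combination (1 / 2) * I_mul_I
  · exact (CliffordSum.ite_one_zero v).congr fun z => by simp
  · refine ite_of_eq_mul 1 ?_ v
    simp [pow_succ]
    linear_combination (1 / 2) * I_mul_I

theorem scatterVert (h : CliffordAmp n ψ) (hk : k + 2 ≤ 2 * n) {θ : ℂ}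
    (hθ : ∃ k : ℤ, θ = k * (Real.pi / 2)) : CliffordAmp n fun x => scatterVert θ k (ψ x) := by
  rcases Nat.even_or_odd' k with ⟨q, rfl | rfl⟩
  · refine h.diagonal (q := q) (c := fun a => if a then exp (I * θ) else 1) ?_ (by omega) ?_
    · obtain ⟨j, -, hj⟩ := exp_eq_I_pow hθ
      rw [hj]
      exact CliffordSum.ite_I_pow _ j
    · intro x u a r hu
      rw [scatterVert_eq, dotPair_even _ _ hu]
      cases a <;> simp <;> ring
  · refine h.flip (q := q) (scatter_coeff none hθ) (by omega) ?_
    intro x u a b r hu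
    rw [scatterVert_eq, dotPair_odd _ _ hu]

theorem scatterHoriz (h : CliffordAmp n ψ) (hk : k + 2 ≤ 2 * n) {θ : ℂ}
    (hθ : ∃ k : ℤ, θ = k * (Real.pi / 2)) : CliffordAmp n fun x => scatterHoriz θ k (ψ x) := by
  rcases Nat.even_or_odd' k with ⟨q, rfl | rfl⟩
  · exact h.diagonal (q := q) ((scatter_coeff (Sum.inr q) hθ).const_mul (fourthRootTwo ^ 2))
      (c := fun a => fourthRootTwo ^ 2 *
        if a then (1 - exp (I * θ)) / 2 else (1 + exp (I * θ)) / 2) (by omega)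
      fun x u a r hu => scatterHoriz_even _ _ _ hu a
  · refine h.flip (q := q) (α := fourthRootTwo⁻¹ ^ 2) (β := fourthRootTwo⁻¹ ^ 2 * exp (I * θ))
      ?_ (by omega) ?_
    · obtain ⟨j, -, hj⟩ := exp_eq_I_pow hθ
      rw [hj]
      exact ite_of_eq_mul j rfl none
    · intro x u a b r hu
      rw [scatterHoriz_odd _ _ _ hu]
      ring

end CliffordAmp

theorem Slice.strings_append_cons (l r : Slice) (c m : ℕ) :
    Slice.strings (l ++ (c, m) :: r) = l.strings + (m + r.strings) := by
  simp [Slice.strings]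

theorem Slice.strings_append (l r : Slice) : Slice.strings (l ++ r) = l.strings + r.strings := by
  simp [Slice.strings]

theorem Slice.strings_cons (r : Slice) (c m : ℕ) :
    Slice.strings ((c, m) :: r) = m + r.strings := by
  simp [Slice.strings]

theorem Slice.even_strings {s : Slice} (h : ∀ p ∈ s, Even p.2) : Even s.strings := by
  induction s with
  | nil => exact ⟨0, rfl⟩
  | cons p s ih =>
    simp only [List.forall_mem_cons] at h
    obtain ⟨c, m⟩ := p
    rw [Slice.strings_cons]
    exact h.1.add (ih h.2)

/-- It ensures that an encoder starts at an even string position, where it acts on two whole modes.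
-/
theorem Partial.even_snd {s : Slice} (D : Partial ι s) : ∀ p ∈ s, Even p.2 := by
  induction D with
  | empty => simp
  | cap i j D ih =>
    simp only [List.forall_mem_append, List.forall_mem_cons] at ih ⊢
    refine ⟨ih.1, ?_, ih.2.2⟩
    obtain ⟨t, ht⟩ := ih.2.1
    exact ⟨t + 1, by omega⟩
  | cup i j D ih =>
    simp only [List.forall_mem_append, List.forall_mem_cons] at ih ⊢
    refine ⟨ih.1, ?_, ih.2.2⟩
    obtain ⟨t, ht⟩ := ih.2.1
    exact ⟨t - 1, by omega⟩
  | dots i m j D ih => exact ih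
  | braid b i j D ih => exact ih
  | scatterV θ i j D ih => exact ih
  | scatterH θ i j D ih => exact ih
  | birth c hc D ih =>
    simp only [List.forall_mem_append, List.forall_mem_cons] at ih ⊢
    exact ⟨ih.1, ⟨0, rfl⟩, ih.2⟩
  | death D ih =>
    simp only [List.forall_mem_append, List.forall_mem_cons] at ih ⊢
    exact ⟨ih.1, ih.2.2⟩
  | split c' i j hc D ih =>
    simp only [List.forall_mem_append, List.forall_mem_cons] at ih ⊢
    exact ⟨ih.1, even_two_mul i, even_two_mul j, ih.2.2⟩
  | join D ih =>
    simp only [List.forall_mem_append, List.forall_mem_cons] at ih ⊢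
    exact ⟨ih.1, ih.2.1.add ih.2.2.1, ih.2.2.2⟩
  | legIn ℓ c hc D ih =>
    simp only [List.forall_mem_append, List.forall_mem_cons] at ih ⊢
    exact ⟨ih.1, ⟨2, rfl⟩, ih.2⟩
  | legOut ℓ D ih =>
    simp only [List.forall_mem_append, List.forall_mem_cons] at ih ⊢
    exact ⟨ih.1, ih.2.2⟩

theorem Partial.cliffordAmp {s : Slice} (D : Partial ι s) (hD : D.NoGenericScattering) :
    ∀ n, s.strings = 2 * n → CliffordAmp n fun x => D.amp x := by
  induction D with
  | empty =>
    intro n hn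
    obtain rfl : n = 0 := by simp [Slice.strings] at hn; omega
    exact (CliffordSum.const 1).congr fun z => by simp [Partial.amp, bits]
  | @cap l r c i j D ih =>
    intro n hn
    rw [Slice.strings_append_cons] at hn
    obtain ⟨n, rfl⟩ : ∃ m, n = m + 1 := ⟨n - 1, by omega⟩
    exact (ih hD n (by rw [Slice.strings_append_cons]; omega)).capAt (by omega)
  | @cup l r c i j D ih =>
    intro n hn
    rw [Slice.strings_append_cons] at hn
    exact (ih hD (n + 1) (by rw [Slice.strings_append_cons]; omega)).cupAt (by omega)
  | @dots l r c i m j D ih =>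
    intro n hn
    have h := ih hD n hn
    rw [Slice.strings_append_cons] at hn
    exact h.dotPair (by omega) (by omega)
  | @braid l r c b i j D ih =>
    intro n hn
    have h := ih hD n hn
    rw [Slice.strings_append_cons] at hn
    exact h.braidAt (by omega) b
  | @scatterV l r c θ i j D ih =>
    intro n hn
    have h := ih hD.2 n hn
    rw [Slice.strings_append_cons] at hn
    exact h.scatterVert (by omega) hD.1
  | @scatterH l r c θ i j D ih =>
    intro n hn
    have h := ih hD.2 n hn
    rw [Slice.strings_append_cons] at hn
    exact h.scatterHoriz (by omega) hD.1
  | birth c hc D ih =>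
    intro n hn
    refine ih hD n ?_
    rw [← hn, Slice.strings_append_cons, Slice.strings_append, zero_add]
  | @death l r c D ih =>
    intro n hn
    refine ih hD n ?_
    rw [← hn, Slice.strings_append_cons, Slice.strings_append, zero_add]
  | @split l r c c' i j hc D ih =>
    intro n hn
    rw [Slice.strings_append_cons, Slice.strings_cons] at hn
    have h := ih hD n (by rw [Slice.strings_append_cons]; omega)
    exact (h.evenProj (by omega)).evenProj (by omega)
  | @join l r c c' m m' D ih =>
    intro n hn
    refine ih hD n ?_
    rw [← hn, Slice.strings_append_cons, Slice.strings_append_cons, Slice.strings_cons, add_assoc]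
  | @legIn l r ℓ c hc D ih =>
    intro n hn
    have he : Even l.strings := Slice.even_strings fun p hp => D.even_snd p
      (List.mem_append_left _ hp)
    obtain ⟨q, hq⟩ := he.two_dvd
    rw [Slice.strings_append_cons] at hn
    obtain ⟨n, rfl⟩ : ∃ m, n = m + 2 := ⟨n - 2, by omega⟩
    have h := (ih hD n (by rw [Slice.strings_append]; omega)).encoderKet (q := q) (by omega) ℓ
    rw [← hq] at h
    exact h
  | @legOut l r c ℓ D ih =>
    intro n hn
    have he : Even l.strings := Slice.even_strings fun p hp => D.even_snd p
      (List.mem_append_left _ hp)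
    obtain ⟨q, hq⟩ := he.two_dvd
    rw [Slice.strings_append] at hn
    have h := (ih hD (n + 2) (by rw [Slice.strings_append_cons]; omega)).encoderBra (q := q)
      (by omega) ℓ
    rw [← hq] at h
    exact h

/-- The tensor of a diagram without generic scattering elements is of the form `CliffordSum`. -/
theorem Diagram.cliffordSum (D : Diagram ι) (hD : D.NoGenericScattering) :
    CliffordSum D.tensor := by
  have h := ((D.body.cliffordAmp hD 0 rfl).const_mul D.coeff)
  -- No occupation number is read on the empty slice, so the mode variables may all be sent to one
  -- leg; without legs the tensor is a constant.
  rcases isEmpty_or_nonempty ι with hι | ⟨⟨ℓ⟩⟩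
  · refine (CliffordSum.const (D.tensor fun _ => false)).congr fun z => ?_
    exact congrArg _ (Subsingleton.elim _ _)
  · exact (h.pullback (Sum.elim id fun _ => ℓ)).congr fun z => rfl

/-! ## Logical qubits on four strings -/

/-- The amplitudes of the state in which every bit of `F` is repeated. -/
def doubled : List Bool → (List Bool → ℂ) → ℂ
  | [], F => F []
  | [_], _ => 0
  | a :: b :: r, F => if a = b then doubled r (fun q => F (a :: q)) else 0

theorem doubled_cons_cons (a b : Bool) (r : List Bool) (F : List Bool → ℂ) :
    doubled (a :: b :: r) F = if a = b then doubled r (fun q => F (a :: q)) else 0 := rfl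

theorem doubled_nil (F : List Bool → ℂ) : doubled [] F = F [] := rfl

/-- A list of even length is a list of repeated bits, or carries no amplitude. -/
theorem doubled_append : ∀ (i : ℕ) (u : List Bool), u.length = 2 * i →
    (Even (u.count true) ∧ ∃ u' : List Bool, u'.length = i ∧
      ∀ w F, doubled (u ++ w) F = doubled w fun q => F (u' ++ q)) ∨
    ∀ w F, doubled (u ++ w) F = 0
  | 0, u, h => by
    obtain rfl := List.length_eq_zero_iff.1 h
    exact Or.inl ⟨by simp, [], rfl, fun w F => rfl⟩
  | i + 1, [], h => by simp at h
  | i + 1, [_], h => by simp at h; omega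
  | i + 1, a :: b :: u, h => by
    by_cases hab : a = b
    · subst hab
      rcases doubled_append i u (by simp at h; omega) with ⟨he, u', hu', h'⟩ | h'
      · refine Or.inl ⟨?_, a :: u', by simp [hu'], fun w F => ?_⟩
        · cases a
          · simpa using he
          · simpa [add_assoc] using he.add even_two
        · simp [doubled_cons_cons, h']
      · exact Or.inr fun w F => by simp [doubled_cons_cons, h']
    · exact Or.inr fun w F => by simp [doubled_cons_cons, hab]

theorem doubled_eq {r : List Bool} {i : ℕ} (h : r.length = 2 * i) :
    (Even (r.count true) ∧ ∃ r' : List Bool, ∀ F, doubled r F = F r') ∨ ∀ F, doubled r F = 0 := by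
  rcases doubled_append i r h with ⟨he, r', -, h⟩ | h
  · exact Or.inl ⟨he, r', fun F => by simpa [doubled_nil] using h [] F⟩
  · exact Or.inr fun F => by simpa using h [] F

/-- The state `φ` on `2 * n` modes encodes the `n`-qubit state `F`, up to the factor `c`. -/
def Encodes (n : ℕ) (F : List Bool → ℂ) (c : ℂ) (φ : Amp) : Prop :=
  ∀ p : List Bool, p.length = 2 * n → φ p = c * doubled p F

theorem exists_eq_append_pair {n i : ℕ} {p : List Bool} (hp : p.length = 2 * n) (hi : i < n) :
    ∃ u a b r, p = u ++ a :: b :: r ∧ u.length = 2 * i ∧ r.length = 2 * (n - i - 1) := by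
  have h1 : 2 * i < p.length := by omega
  have h2 : 2 * i + 1 < p.length := by omega
  refine ⟨p.take (2 * i), p[2 * i], p[2 * i + 1], p.drop (2 * i + 2), ?_, ?_, ?_⟩
  · rw [List.getElem_cons_drop (h := h2), List.getElem_cons_drop (h := h1), List.take_append_drop]
  · simp; omega
  · simp; omega

/-- Phase gate on the bit `i`. -/
def phaseBit (i : ℕ) (F : List Bool → ℂ) : List Bool → ℂ :=
  fun q => (if q.getD i false then I else 1) * F q

/-- Quarter rotation about the `X` axis of the bit `i`. -/
def rotateBit (i : ℕ) (F : List Bool → ℂ) : List Bool → ℂ :=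
  fun q => ∑ b : Bool, (if xor b (q.getD i false) then -I else 1) * F (q.set i b)

/-- Hadamard gate on the bit `i`. -/
def hadamardBit (i : ℕ) (F : List Bool → ℂ) : List Bool → ℂ :=
  phaseBit i (rotateBit i (phaseBit i F))

/-- The bit `i` is copied. -/
def copyBit (i : ℕ) (F : List Bool → ℂ) : List Bool → ℂ :=
  fun q => if q.getD i false = q.getD (i + 1) false then F (q.eraseIdx i) else 0

/-- The bits `i` and `i + 1` are merged. -/
def mergeBit (i : ℕ) (F : List Bool → ℂ) : List Bool → ℂ :=
  fun q => F (q.take (i + 1) ++ q.drop i)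

theorem getD_append_cons {i : ℕ} {u : List Bool} (hu : u.length = i) (a : Bool) (r : List Bool) :
    (u ++ a :: r).getD i false = a := by
  subst hu; simp

theorem set_append_cons {i : ℕ} {u : List Bool} (hu : u.length = i) (a b : Bool) (r : List Bool) :
    (u ++ a :: r).set i b = u ++ b :: r := by
  subst hu; simp

theorem getD_append_cons_cons {i : ℕ} {u : List Bool} (hu : u.length = i) (a b : Bool)
    (r : List Bool) : (u ++ a :: b :: r).getD (i + 1) false = b := by
  have := getD_append_cons (u := u ++ [a]) (i := i + 1) (by simp [hu]) b r
  simpa using this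

theorem set_append_cons_cons {i : ℕ} {u : List Bool} (hu : u.length = i) (a b c : Bool)
    (r : List Bool) : (u ++ a :: b :: r).set (i + 1) c = u ++ a :: c :: r := by
  have := set_append_cons (u := u ++ [a]) (i := i + 1) (by simp [hu]) b c r
  simpa using this

theorem eraseIdx_append_cons {i : ℕ} {u : List Bool} (hu : u.length = i) (a : Bool)
    (r : List Bool) : (u ++ a :: r).eraseIdx i = u ++ r := by
  subst hu; simp [List.eraseIdx_append_of_length_le]

theorem mergeBit_append_cons {i : ℕ} {u : List Bool} (hu : u.length = i) (a : Bool)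
    (r : List Bool) (F : List Bool → ℂ) : mergeBit i F (u ++ a :: r) = F (u ++ a :: a :: r) := by
  subst hu
  simp [mergeBit, List.take_append, List.take_of_length_le]

theorem copyBit_append_cons {i : ℕ} {u : List Bool} (hu : u.length = i) (a b : Bool)
    (r : List Bool) (F : List Bool → ℂ) :
    copyBit i F (u ++ a :: b :: r) = if a = b then F (u ++ b :: r) else 0 := by
  simp only [copyBit, getD_append_cons hu, getD_append_cons_cons hu, eraseIdx_append_cons hu]

/-- The rotated copy of the first bit carries (-1)^{ab}; merging it with the second bit sets its
value to b. -/
theorem mergeBit_hadamardBit_copyBit {i : ℕ} {u : List Bool} (hu : u.length = i) (a b : Bool)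
    (r : List Bool) (F : List Bool → ℂ) :
    mergeBit (i + 1) (hadamardBit (i + 1) (copyBit i F)) (u ++ a :: b :: r) =
      (if a && b then -1 else 1) * F (u ++ a :: b :: r) := by
  have h := mergeBit_append_cons (u := u ++ [a]) (i := i + 1) (by simp [hu]) b r
    (hadamardBit (i + 1) (copyBit i F))
  simp only [List.append_assoc, List.singleton_append] at h
  rw [h]
  simp only [hadamardBit, phaseBit, rotateBit, getD_append_cons_cons hu, set_append_cons_cons hu,
    copyBit_append_cons hu, Fintype.sum_bool]
  cases a <;> cases b <;> simp
  all_goals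
    rw [← mul_assoc, I_mul_I]
    ring

namespace Encodes

variable {n i : ℕ} {F : List Bool → ℂ} {c : ℂ} {φ : Amp}

theorem const_one : Encodes 0 (fun _ => 1) 1 (fun p => if p = [] then 1 else 0) := by
  intro p hp
  obtain rfl := List.length_eq_zero_iff.1 hp
  simp [doubled_nil]

/-- The strings 4i and 4i + 1 form the first mode of the qubit i, whose occupation number is the
logical bit; the braid acts on it as (1 - i) diag(1, i) up to `braidCoeff`. -/
theorem phase (h : Encodes n F c φ) (hi : i < n) :
    Encodes n (phaseBit i F) (c * (braidCoeff false * (1 - I))) (braidAt false (4 * i) φ) := by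
  intro p hp
  rw [braidAt_eq, h p hp]
  obtain ⟨u, a, b, r, rfl, hu, hr⟩ := exists_eq_append_pair hp hi
  have e := dotPair_even (q := 2 * i) φ (b :: r) hu a
  rw [h _ hp, ← mul_assoc, show 2 * 2 * i = 4 * i by ring] at e
  norm_num at e
  rw [e]
  rcases doubled_append i u hu with ⟨-, u', hu', hd⟩ | hd
  · rw [hd, hd, doubled_cons_cons, doubled_cons_cons]
    rcases doubled_eq hr with ⟨-, r', hr'⟩ | hr'
    · rw [hr', hr', phaseBit, getD_append_cons hu']
      cases a <;> cases b <;> simp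
      · ring
      · linear_combination (c * braidCoeff false * F (u' ++ true :: r')) * I_mul_I
    · simp [hr']
  · simp [hd]

/-- The middle pair of strings flips both modes of the qubit together, which preserves the code and
acts as logical X. -/
theorem rotate (h : Encodes n F c φ) (hi : i < n) :
    Encodes n (rotateBit i F) (c * braidCoeff false) (braidAt false (4 * i + 1) φ) := by
  intro p hp
  rw [braidAt_eq, h p hp]
  obtain ⟨u, a, b, r, rfl, hu, hr⟩ := exists_eq_append_pair hp hi
  have e := dotPair_odd (q := 2 * i) φ r hu a b
  rw [h _ (by simpa using hp), show 2 * (2 * i) = 4 * i by ring] at e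
  rw [show 4 * i + 1 + 1 = 4 * i + 2 by rfl, e]
  rcases doubled_append i u hu with ⟨-, u', hu', hd⟩ | hd
  · rw [hd, hd, hd, doubled_cons_cons, doubled_cons_cons, doubled_cons_cons]
    rcases doubled_eq hr with ⟨-, r', hr'⟩ | hr'
    · simp only [hr', rotateBit, getD_append_cons hu', set_append_cons hu', Fintype.sum_bool]
      cases a <;> cases b <;> simp <;> ring
    · simp [hr']
  · simp [hd]

theorem hadamard (h : Encodes n F c φ) (hi : i < n) :
    Encodes n (hadamardBit i F)
      (c * (braidCoeff false * (1 - I)) * braidCoeff false * (braidCoeff false * (1 - I)))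
      (braidAt false (4 * i) (braidAt false (4 * i + 1) (braidAt false (4 * i) φ))) :=
  ((h.phase hi).rotate hi).phase hi

/-- The nested cups remove the second mode of qubit i and the first mode of qubit i + 1 and force
them to be equal; the code then equates the two outer modes, which form the merged qubit. -/
theorem merge (h : Encodes (n + 1) F c φ) (hi : i < n) :
    Encodes n (mergeBit i F) c (cupAt (4 * i + 2) (cupAt (4 * i + 3) φ)) := by
  intro p hp
  obtain ⟨u, a, b, r, rfl, hu, hr⟩ := exists_eq_append_pair hp hi
  have hu1 : (u ++ [a]).length = 2 * i + 1 := by simp [hu]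
  have e1 := cupAt_even (cupAt (4 * i + 3) φ) (b :: r) hu1
  have e2 := cupAt_odd φ (b :: r) hu1 false
  rw [show 2 * (2 * i + 1) = 4 * i + 2 by ring] at e1 e2
  rw [e2, ← mul_assoc, mul_inv_cancel₀ fourthRootTwo_ne_zero] at e1
  simp only [List.append_assoc, List.singleton_append, Fintype.sum_bool, Bool.xor_false] at e1
  have hl : ∀ e : Bool, (u ++ a :: e :: e :: b :: r).length = 2 * (n + 1) := fun e => by
    simp at hp ⊢; omega
  rw [e1, h _ (hl _), h _ (hl _)]
  rcases doubled_append i u hu with ⟨-, u', hu', hd⟩ | hd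
  · simp only [hd, doubled_cons_cons]
    rcases doubled_eq hr with ⟨-, r', hr'⟩ | hr'
    · simp only [hr', mergeBit_append_cons hu']
      cases a <;> cases b <;> simp
    · simp [hr']
  · simp [hd]

theorem sum (h : Encodes (n + 1) F c φ) :
    Encodes n (fun q => ∑ b : Bool, F (b :: q)) c (cupAt 0 (cupAt 1 φ)) := by
  intro p hp
  have e1 := cupAt_even (q := 0) (u := []) (cupAt 1 φ) p rfl
  have e2 := cupAt_odd (q := 0) (u := []) φ p rfl false
  simp only [List.nil_append, mul_zero, zero_add] at e1 e2
  rw [e1, e2, ← mul_assoc, mul_inv_cancel₀ fourthRootTwo_ne_zero]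
  simp only [Fintype.sum_bool, Bool.xor_false]
  rw [h _ (by simp; omega), h _ (by simp; omega)]
  rcases doubled_eq hp with ⟨-, r', hr'⟩ | hr'
  · simp [doubled_cons_cons, hr']
    ring
  · simp [doubled_cons_cons, hr']

/-- Two nested caps create the Bell pair of modes, which encodes |0⟩ + |1⟩. -/
theorem plus (h : Encodes n (fun _ => 1) c φ) :
    Encodes (n + 1) (fun _ => 1) c (capAt 1 (capAt 0 φ)) := by
  intro p hp
  obtain ⟨u, a, b, r, rfl, hu, hr⟩ := exists_eq_append_pair hp (Nat.succ_pos n)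
  obtain rfl := List.length_eq_zero_iff.1 hu
  have e1 := capAt_odd (q := 0) (u := []) (capAt 0 φ) r rfl a b
  have e2 := capAt_even (q := 0) (u := []) φ r rfl (xor a b)
  simp only [List.nil_append, mul_zero, zero_add] at e1 e2 ⊢
  rw [e1, e2, h r (by omega), doubled_cons_cons]
  have := fourthRootTwo_ne_zero
  cases a <;> cases b <;> simp [this]

/-- Nested caps between the two modes a, b' of a qubit insert an equal pair b = a', still
independent of a. Everything to the left has even parity, so the projection of the left part forces
a = b, and two copies of the qubit result. -/
theorem copy (h : Encodes n F c φ) (hi : i < n) :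
    Encodes (n + 1) (copyBit i F) c
      (evenProj 0 (2 * i + 2) (evenProj (2 * i + 2) (2 * (n - i))
        (capAt (4 * i + 3) (capAt (4 * i + 2) φ)))) := by
  intro p hp
  obtain ⟨u, a, b, r, rfl, hu, hr⟩ := exists_eq_append_pair hp (show i < n + 1 by omega)
  obtain ⟨v, a', b', r, rfl, hv, hr'⟩ := exists_eq_append_pair hr (show 0 < _ by omega)
  obtain rfl := List.length_eq_zero_iff.1 hv
  clear hv
  simp only [List.nil_append] at *
  have p1 := evenProj_eq (q := 0) (u := []) (evenProj (2 * i + 2) (2 * (n - i))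
        (capAt (4 * i + 3) (capAt (4 * i + 2) φ))) (a' :: b' :: r) (2 * i + 2) rfl (u ++ [a, b])
        (by simp [hu])
  have p2 := evenProj_eq (q := 2 * i + 2) (u := u ++ [a, b])
        (capAt (4 * i + 3) (capAt (4 * i + 2) φ)) [] (2 * (n - i)) (by simp [hu]) (a' :: b' :: r)
        (by rw [hr]; omega)
  simp only [List.nil_append, List.append_nil, List.append_assoc, List.cons_append] at p1 p2
  have hu1 : (u ++ [a]).length = 2 * i + 1 := by simp [hu]
  have e1 := capAt_odd (capAt (4 * i + 2) φ) (b' :: r) hu1 b a'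
  have e2 := capAt_even φ (b' :: r) hu1 (xor b a')
  rw [show 2 * (2 * i + 1) = 4 * i + 2 by ring] at e1 e2
  rw [e2] at e1
  simp only [List.append_assoc, List.singleton_append] at e1
  rw [p1, p2, e1, h (u ++ a :: b' :: r) (by simp at hp ⊢; omega)]
  have hf := fourthRootTwo_ne_zero
  rcases doubled_append i u hu with ⟨hue, u', hu', hd⟩ | hd
  · simp only [hd, doubled_cons_cons]
    rcases doubled_eq (i := n - i - 1) (r := r) (by omega) with ⟨hre, r', hr'⟩ | hr'
    · simp only [hr', copyBit_append_cons hu', List.count_append, List.count_cons]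
      cases a <;> cases b <;> cases a' <;> cases b' <;>
        simp [hf, hue, hre, Nat.even_add_one, add_assoc]
    · simp [hr']
  · simp [hd]

/-- The controlled phase gate: copy the first bit, rotate the copy, and merge it with the second. -/
theorem controlledZ (h : Encodes n F c φ) (hi : i + 1 < n) :
    Encodes n (mergeBit (i + 1) (hadamardBit (i + 1) (copyBit i F)))
      (c * (braidCoeff false * (1 - I)) * braidCoeff false * (braidCoeff false * (1 - I)))
      (cupAt (4 * (i + 1) + 2) (cupAt (4 * (i + 1) + 3)
        (braidAt false (4 * (i + 1)) (braidAt false (4 * (i + 1) + 1) (braidAt false (4 * (i + 1))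
          (evenProj 0 (2 * i + 2) (evenProj (2 * i + 2) (2 * (n - i))
            (capAt (4 * i + 3) (capAt (4 * i + 2) φ))))))))) :=
  ((h.copy (by omega)).hadamard (by omega)).merge hi

end Encodes

/-! ### Moves on diagrams and their boundary circles -/

/-- The family of amplitudes `ψ` is that of a partial diagram without generic scattering elements,
with boundary `b` and tensor legs `L`. -/
def Reach (s : Slice) (b : Equiv.Perm (ι ⊕ ℕ)) (L : List ι) (ψ : (ι → Bool) → Amp) : Prop :=
  ∃ D : Partial ι s, D.NoGenericScattering ∧ D.boundary = b ∧ D.legs = L ∧ ∀ x, D.amp x = ψ x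

theorem delete_of_fixed {α : Type} {z : α} {f : Equiv.Perm α} (h : f z = z) : delete z f = f := by
  have h1 : transp z z = 1 := @Equiv.swap_self α (Classical.decEq α) z
  rw [delete, h, h1, one_mul]

namespace Reach

variable {b : Equiv.Perm (ι ⊕ ℕ)} {L : List ι} {ψ : (ι → Bool) → Amp} {c d k m : ℕ}

theorem birth : Reach [(0, 0)] 1 ([] : List ι) fun _ p => if p = [] then 1 else 0 :=
  have hc : 0 ∉ Slice.names ([] ++ []) := by simp [Slice.names]
  ⟨.birth (l := []) (r := []) 0 hc .empty, trivial, rfl, rfl, fun _ => rfl⟩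

theorem cap (h : Reach [(c, m)] b L ψ) (hk : k ≤ m) :
    Reach [(c, m + 2)] b L fun x => capAt k (ψ x) := by
  obtain ⟨j, rfl⟩ := Nat.exists_eq_add_of_le hk
  obtain ⟨D, h1, h2, h3, h4⟩ := h
  rw [add_right_comm]
  refine ⟨.cap (l := []) (r := []) k j D, h1, h2, h3, fun x => ?_⟩
  simp [Partial.amp, h4, Slice.strings]

theorem cup (h : Reach [(c, m + 2)] b L ψ) (hk : k ≤ m) :
    Reach [(c, m)] b L fun x => cupAt k (ψ x) := by
  obtain ⟨j, rfl⟩ := Nat.exists_eq_add_of_le hk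
  rw [add_right_comm] at h
  obtain ⟨D, h1, h2, h3, h4⟩ := h
  refine ⟨.cup (l := []) (r := []) k j D, h1, h2, h3, fun x => ?_⟩
  simp [Partial.amp, h4, Slice.strings]

theorem braid {l : Slice} (h : Reach (l ++ [(c, m)]) b L ψ) (hl : l.strings = 0) (hk : k + 2 ≤ m)
    (positive : Bool) : Reach (l ++ [(c, m)]) b L fun x => braidAt positive k (ψ x) := by
  obtain ⟨j, rfl⟩ := Nat.exists_eq_add_of_le hk
  obtain ⟨D, h1, h2, h3, h4⟩ := h
  refine ⟨.braid (r := []) positive k j D, h1, h2, h3, fun x => ?_⟩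
  simp [Partial.amp, h4, hl]

/-- An interval is split into two, which are joined again. -/
theorem splitJoin {i j : ℕ} (h : Reach [(0, m)] b L ψ) (hb : b (Sum.inr 1) = Sum.inr 1)
    (hm : m = 2 * i + 2 * j) :
    Reach [(0, m)] b L fun x => evenProj 0 i (evenProj i j (ψ x)) := by
  subst hm
  obtain ⟨D, h1, h2, h3, h4⟩ := h
  have hc : 1 ∉ Slice.names ([] ++ (0, 2 * i + 2 * j) :: []) := by simp [Slice.names]
  refine ⟨.join (l := []) (r := []) (.split (l := []) (r := []) 1 i j hc D),
    h1, ?_, h3, fun x => ?_⟩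
  -- The hole between split and join carries no leg, so the two transpositions cancel and the name 1
  -- becomes a fixed point.
  · simp only [Partial.boundary]
    rw [mul_assoc, transp_mul_self, mul_one, h2, delete_of_fixed hb]
  · simp [Partial.amp, h4, Slice.strings]

/-- An interval without strings is split off on the left. -/
theorem splitLeft (h : Reach [(0, 4 * k)] b L ψ) :
    Reach [(0, 0), (1, 4 * k)] (b * transp (Sum.inr 0) (Sum.inr 1)) L
      fun x => evenProj 0 0 (evenProj 0 (2 * k) (ψ x)) := by
  rw [show 4 * k = 2 * 0 + 2 * (2 * k) by ring] at h
  obtain ⟨D, h1, h2, h3, h4⟩ := h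
  rw [show 4 * k = 2 * (2 * k) by ring]
  have hc : 1 ∉ Slice.names ([] ++ (0, 2 * 0 + 2 * (2 * k)) :: []) := by simp [Slice.names]
  refine ⟨.split (l := []) (r := []) 1 0 (2 * k) hc D, h1, ?_, h3,
    fun x => ?_⟩
  · simp only [Partial.boundary, h2]
  · simp [Partial.amp, h4, Slice.strings]

/-- The first four strings of the second interval go out at a tensor leg. -/
theorem legOut (h : Reach [(0, 0), (d, 4 * (k + 1))] b L ψ) (ℓ : ι) :
    Reach [(0, 0), (d + 1, 4 * k)] (transp (Sum.inl ℓ) (Sum.inr d) *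
        (b * transp (Sum.inr d) (Sum.inr (d + 1))) * transp (Sum.inl ℓ) (Sum.inr d)) (ℓ :: L)
      fun x => encoderBra (x ℓ) 0 (evenProj 0 2 (evenProj 2 (2 * k) (ψ x))) := by
  rw [show 4 * (k + 1) = 2 * 2 + 2 * (2 * k) by ring] at h
  obtain ⟨D, h1, h2, h3, h4⟩ := h
  rw [show 4 * k = 2 * (2 * k) by ring]
  have hc : d + 1 ∉ Slice.names ([(0, 0)] ++ (d, 2 * 2 + 2 * (2 * k)) :: []) := by
    simp [Slice.names]
  refine ⟨.legOut (l := [(0, 0)]) (r := [(d + 1, 2 * (2 * k))]) ℓ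
    (.split (l := [(0, 0)]) (r := []) (d + 1) 2 (2 * k) hc D),
    h1, ?_, ?_, fun x => ?_⟩
  · simp only [Partial.boundary, h2]
  · simp only [Partial.legs, h3]
  · simp [Partial.amp, h4, Slice.strings]

/-- The two intervals are joined. -/
theorem join (h : Reach [(0, 0), (d, 4 * k)] b L ψ) :
    Reach [(0, 4 * k)] (delete (Sum.inr d) (b * transp (Sum.inr 0) (Sum.inr d))) L ψ := by
  obtain ⟨D, h1, h2, h3, h4⟩ := h
  rw [← zero_add (4 * k)]
  refine ⟨.join (l := []) (r := []) D, h1, ?_, h3, fun x => ?_⟩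
  · simp only [Partial.boundary, h2]
  · simp [Partial.amp, h4]

theorem death (h : Reach [(c, 0)] b L ψ) (hb : b (Sum.inr c) = Sum.inr c) : Reach [] b L ψ := by
  obtain ⟨D, h1, h2, h3, h4⟩ := h
  refine ⟨.death (l := []) (r := []) D, h1, ?_, h3, fun x => ?_⟩
  · simp only [Partial.boundary, h2, delete_of_fixed hb]
  · simp [Partial.amp, h4]

/-- A Hadamard gate on the logical qubit `i` of the last interval. -/
theorem hadamard {l : Slice} {n i : ℕ} (h : Reach (l ++ [(c, 4 * n)]) b L ψ) (hl : l.strings = 0)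
    (hi : i < n) : Reach (l ++ [(c, 4 * n)]) b L fun x =>
      braidAt false (4 * i) (braidAt false (4 * i + 1) (braidAt false (4 * i) (ψ x))) :=
  ((h.braid hl (by omega) false).braid hl (by omega) false).braid hl (by omega) false

end Reach

/-! ## Preparation of states in a disk -/

/-- The tensor `T` is encoded, up to a nonzero factor, by a diagram in a disk without tensor legs. -/
def Preparable (ι : Type) (n : ℕ) (T : (Fin n → Bool) → ℂ) : Prop :=
  ∃ F : List Bool → ℂ, (∀ z, F (List.ofFn z) = T z) ∧ ∃ (ψ : (ι → Bool) → Amp) (c : ℂ), c ≠ 0 ∧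
    Reach [(0, 4 * n)] 1 [] ψ ∧ ∀ x, Encodes n F c (ψ x)

theorem doubled_const_mul (t : ℂ) {p : List Bool} {n : ℕ} (hp : p.length = 2 * n)
    (F : List Bool → ℂ) : doubled p (fun q => t * F q) = t * doubled p F := by
  rcases doubled_eq hp with ⟨-, r', h⟩ | h <;> simp [h]

theorem hadamard_coeff_ne_zero {c : ℂ} (hc : c ≠ 0) :
    c * (braidCoeff false * (1 - I)) * braidCoeff false * (braidCoeff false * (1 - I)) ≠ 0 := by
  have hI : (1 - I) ≠ 0 := fun h => by simpa using congrArg Complex.re h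
  have := braidCoeff_ne_zero false
  positivity

theorem getD_ofFn {n : ℕ} (z : Fin n → Bool) (i : Fin n) : (List.ofFn z).getD i false = z i := by
  simp

theorem set_ofFn {n : ℕ} (z : Fin n → Bool) (i : Fin n) (b : Bool) :
    (List.ofFn z).set i b = List.ofFn (Function.update z i b) := by
  refine List.ext_getElem (by simp) fun k h1 h2 => ?_
  simp only [List.getElem_set, List.getElem_ofFn, Function.update_apply, Fin.ext_iff, eq_comm]

theorem take_append_getD {q : List Bool} {i : ℕ} (h : i + 1 < q.length) :
    q.take i ++ q.getD i false :: q.getD (i + 1) false :: q.drop (i + 2) = q := by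
  rw [List.getD_eq_getElem _ _ h, List.getD_eq_getElem _ _ (by omega : i < q.length),
    List.getElem_cons_drop (h := h), List.getElem_cons_drop, List.take_append_drop]

/-- All logical gates act on one interval and leave the boundary permutation trivial; only the
controlled phase opens a hole, for the parity projection of the copy. -/
theorem Preparable.cliffordClosed : CliffordClosed (Preparable ι) where
  one n := by
    refine ⟨fun _ => 1, fun _ => rfl, ?_⟩
    induction n with
    | zero => exact ⟨_, 1, one_ne_zero, Reach.birth, fun _ => Encodes.const_one⟩
    | succ n ih =>
      obtain ⟨ψ, c, hc, hR, hE⟩ := ih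
      exact ⟨_, c, hc, (hR.cap (Nat.zero_le _)).cap (by omega), fun x => (hE x).plus⟩
  smul {n T} t ht h := by
    obtain ⟨F, hF, ψ, c, hc, hR, hE⟩ := h
    refine ⟨fun q => t * F q, fun z => congrArg _ (hF z), ψ, c / t, div_ne_zero hc ht, hR,
      fun x p hp => ?_⟩
    rw [hE x p hp, doubled_const_mul _ hp]
    field_simp
  phase {n T} i h := by
    obtain ⟨F, hF, ψ, c, hc, hR, hE⟩ := h
    have hI : (1 - I) ≠ 0 := fun h => by simpa using congrArg Complex.re h
    refine ⟨phaseBit i F, fun z => by rw [phaseBit, getD_ofFn, hF], _, _,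
      mul_ne_zero hc (mul_ne_zero (braidCoeff_ne_zero false) hI),
      hR.braid (l := []) rfl (k := 4 * i) (by omega) false, fun x => (hE x).phase i.2⟩
  hadamard {n T} i h := by
    obtain ⟨F, hF, ψ, c, hc, hR, hE⟩ := h
    refine ⟨hadamardBit i F, fun z => ?_, _, _, hadamard_coeff_ne_zero hc,
      hR.hadamard (l := []) rfl i.2, fun x => (hE x).hadamard i.2⟩
    simp only [hadamardBit, phaseBit, rotateBit, set_ofFn, getD_ofFn, hF, hadamard_eq_phase]
  controlledZ {n T} i h := by
    obtain ⟨F, hF, ψ, c, hc, hR, hE⟩ := h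
    have hi := i.2
    refine ⟨mergeBit (i + 1) (hadamardBit (i + 1) (copyBit i F)), fun z => ?_, _, _,
      hadamard_coeff_ne_zero hc, ?_, fun x => (hE x).controlledZ (i := i) (by omega)⟩
    · have h1 : ((i : ℕ) + 1) < (List.ofFn z).length := by simp
      have h2 := mergeBit_hadamardBit_copyBit (u := (List.ofFn z).take i) (i := i)
        (by simp; omega) ((List.ofFn z).getD i false) ((List.ofFn z).getD (i + 1) false)
        ((List.ofFn z).drop (i + 2)) F
      rw [take_append_getD h1, hF] at h2
      rw [h2, controlledZ, ← getD_ofFn z i.castSucc, ← getD_ofFn z i.succ]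
      rfl
    · have h1 := ((hR.cap (k := 4 * i + 2) (by omega)).cap (k := 4 * i + 3) (by omega)).splitJoin
        (i := 2 * i + 2) (j := 2 * (n + 1 - i)) rfl (by omega)
      have h2 := (h1.hadamard (l := []) (n := n + 2) (i := i + 1) rfl (by omega))
      exact (h2.cup (m := 4 * (n + 1) + 2) (by omega)).cup (by omega)
  sum {n T} h := by
    obtain ⟨F, hF, ψ, c, hc, hR, hE⟩ := h
    refine ⟨_, fun z => ?_, _, c, hc, (hR.cup (m := 4 * n + 2) (k := 1) (by omega)).cup
      (k := 0) (by omega), fun x => (hE x).sum⟩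
    refine Finset.sum_congr rfl fun b _ => ?_
    rw [← hF, List.ofFn_cons]

/-! ### Read-out of the logical qubits with a prescribed layout -/

namespace Encodes

variable {n i j : ℕ} {F : List Bool → ℂ} {c : ℂ} {φ : Amp}

/-- Every block of doubled bits has even parity, so cutting an interval between logical qubits does
not change the state. -/
theorem evenProj (h : Encodes n F c φ) (hij : i + j ≤ n) :
    Encodes n F c (evenProj (2 * i) (2 * j) φ) := by
  intro p hp
  have e := evenProj_eq (q := 2 * i) (u := p.take (2 * i)) φ ((p.drop (2 * i)).drop (2 * j))
    (2 * j) (by simp; omega) ((p.drop (2 * i)).take (2 * j)) (by simp; omega)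
  have hs : p.take (2 * i) ++ (p.drop (2 * i)).take (2 * j) ++ (p.drop (2 * i)).drop (2 * j) = p :=
      by
    rw [List.append_assoc, List.take_append_drop, List.take_append_drop]
  rw [hs, h p hp] at e
  rw [e]
  rcases doubled_append i (p.take (2 * i)) (by simp; omega) with ⟨-, u', -, hu⟩ | hu
  · rcases doubled_append j ((p.drop (2 * i)).take (2 * j)) (by simp; omega) with ⟨hw, -⟩ | hw
    · rw [if_pos hw]
    · have : doubled p F = 0 := by rw [← hs, List.append_assoc, hu, hw]
      simp [this]
  · have : doubled p F = 0 := by rw [← hs, List.append_assoc, hu]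
    simp [this]

theorem encoderBra (h : Encodes (n + 1) F c φ) (x : Bool) :
    Encodes n (fun q => ∑ b : Bool, (if x && b then -1 else 1) * F (b :: q)) c
      (encoderBra x 0 φ) := by
  intro p hp
  have e := encoderBra_eq (q := 0) (u := []) φ p x rfl
  simp only [List.nil_append, mul_zero] at e
  rw [e]
  simp only [Fintype.sum_bool]
  rw [h _ (by simp; omega), h _ (by simp; omega)]
  rcases doubled_eq hp with ⟨-, r', hr'⟩ | hr'
  · cases x <;> simp [doubled_cons_cons, hr'] <;> ring
  · simp [doubled_cons_cons, hr']

end Encodes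

/-- The basis encoder reads a logical qubit in the Hadamard basis; a Hadamard gate before the
read-out compensates this. -/
theorem sum_hadamardBit_zero (F : List Bool → ℂ) (x : Bool) (q : List Bool) :
    ∑ b : Bool, (if x && b then -1 else 1) * hadamardBit 0 F (b :: q) = 2 * F (x :: q) := by
  simp only [hadamardBit, phaseBit, rotateBit, List.getD_cons_zero, List.set_cons_zero,
    Fintype.sum_bool]
  cases x <;> simp
  · linear_combination -F (false :: q) * I_mul_I
  · linear_combination (F (false :: q) - 2 * F (true :: q)) * I_mul_I

/-- A logical qubit is read out at the tensor leg `ℓ`. -/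
theorem Reach.readOut {b : Equiv.Perm (ι ⊕ ℕ)} {L : List ι} {ψ : (ι → Bool) → Amp} {d k : ℕ}
    {F : (ι → Bool) → List Bool → ℂ} {c : ℂ} (h : Reach [(0, 0), (d, 4 * (k + 1))] b L ψ)
    (hc : c ≠ 0) (hE : ∀ x, Encodes (k + 1) (F x) c (ψ x)) (ℓ : ι) :
    ∃ (ψ' : (ι → Bool) → Amp) (c' : ℂ), c' ≠ 0 ∧
      Reach [(0, 0), (d + 1, 4 * k)] (transp (Sum.inl ℓ) (Sum.inr d) *
        (b * transp (Sum.inr d) (Sum.inr (d + 1))) * transp (Sum.inl ℓ) (Sum.inr d)) (ℓ :: L) ψ' ∧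
      ∀ x, Encodes k (fun q => F x (x ℓ :: q)) c' (ψ' x) := by
  refine ⟨_, 2 * _, mul_ne_zero two_ne_zero (hadamard_coeff_ne_zero hc),
    (h.hadamard (l := [(0, 0)]) (i := 0) rfl (Nat.succ_pos k)).legOut ℓ, fun x => ?_⟩
  have h1 := ((((hE x).hadamard (i := 0) (Nat.succ_pos k)).evenProj (i := 1) (j := k)
    (by omega)).evenProj (i := 0) (j := 1) (by omega)).encoderBra (x ℓ)
  intro p hp
  rw [h1 p hp]
  simp only [sum_hadamardBit_zero]
  rw [doubled_const_mul _ hp]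
  ring

/-- A diagram without generic scattering elements has the layout `σ`, the tensor legs `L` and, up to
a nonzero factor, the tensor `T`. -/
def Drawable (σ : Equiv.Perm ι) (L : List ι) (T : (ι → Bool) → ℂ) : Prop :=
  ∃ D : Partial ι [], D.NoGenericScattering ∧ D.boundary = Equiv.sumCongr σ 1 ∧ D.legs = L ∧
    ∃ c : ℂ, c ≠ 0 ∧ ∀ x, D.amp x [] = c * T x

/-- The legs outside the finite set `S` can be read out from a disk, in a suitable order, such that
the layout becomes `σ`, if the cycles of `σ` in `S` are already present. -/
def ReadableFrom [Fintype ι] [DecidableEq ι] (σ : Equiv.Perm ι) (k : ℕ) : Prop :=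
  ∀ S : Finset ι, Sᶜ.card = k → (∀ x ∈ S, σ.symm x ∈ S) →
    ∃ L : List ι, L.Nodup ∧ (∀ x, x ∈ L ↔ x ∉ S) ∧
      ∀ (b : Equiv.Perm (ι ⊕ ℕ)) (L₀ : List ι) (ψ : (ι → Bool) → Amp)
        (F : (ι → Bool) → List Bool → ℂ) (c : ℂ),
        (∀ x ∈ S, b (Sum.inl x) = Sum.inl (σ x)) → (∀ x, x ∉ S → b (Sum.inl x) = Sum.inl x) →
        (∀ j, b (Sum.inr j) = Sum.inr j) → Reach [(0, 4 * k)] b L₀ ψ → c ≠ 0 →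
        (∀ x, Encodes k (F x) c (ψ x)) →
        Drawable σ (L.reverse ++ L₀) fun x => F x (L.map x)

/-- As `ReadableFrom`, if a cycle of `σ` in `S` that starts with `a` is present up to its member
`e`. -/
def ReadableWithin [Fintype ι] [DecidableEq ι] (σ : Equiv.Perm ι) (k : ℕ) : Prop :=
  ∀ (S : Finset ι) (a e : ι) (d : ℕ), Sᶜ.card = k → a ∈ S → e ∈ S → d ≠ 0 →
    (∀ x ∈ S, x ≠ a → σ.symm x ∈ S ∧ σ.symm x ≠ e) →
    ∃ L : List ι, L.Nodup ∧ (∀ x, x ∈ L ↔ x ∉ S) ∧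
      ∀ (b : Equiv.Perm (ι ⊕ ℕ)) (L₀ : List ι) (ψ : (ι → Bool) → Amp)
        (F : (ι → Bool) → List Bool → ℂ) (c : ℂ),
        (∀ x ∈ S, x ≠ e → b (Sum.inl x) = Sum.inl (σ x)) → b (Sum.inl e) = Sum.inr d →
        (∀ x, x ∉ S → b (Sum.inl x) = Sum.inl x) → b (Sum.inr 0) = Sum.inl a →
        b (Sum.inr d) = Sum.inr 0 → (∀ j, j ≠ 0 → j ≠ d → b (Sum.inr j) = Sum.inr j) →
        Reach [(0, 0), (d, 4 * k)] b L₀ ψ → c ≠ 0 → (∀ x, Encodes k (F x) c (ψ x)) →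
        Drawable σ (L.reverse ++ L₀) fun x => F x (L.map x)

section ReadOut

variable [Fintype ι] [DecidableEq ι] {σ : Equiv.Perm ι}

theorem card_compl_insert {S : Finset ι} {a : ι} {k : ℕ} (ha : a ∉ S) (h : Sᶜ.card = k + 1) :
    (insert a S)ᶜ.card = k := by
  rw [Finset.compl_insert, Finset.card_erase_of_mem (by simpa using ha), h]
  rfl

theorem nodup_cons_of_insert {ι : Type} [DecidableEq ι] {S : Finset ι} {a : ι} {L : List ι}
    (ha : a ∉ S) (hL : L.Nodup)
    (hS : ∀ x, x ∈ L ↔ x ∉ insert a S) : (a :: L).Nodup ∧ ∀ x, x ∈ a :: L ↔ x ∉ S := by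
  constructor
  · rw [List.nodup_cons]
    exact ⟨fun h => (hS a).1 h (Finset.mem_insert_self a S), hL⟩
  · intro x
    rw [List.mem_cons, hS, Finset.mem_insert]
    by_cases hx : x = a
    · subst hx; simp [ha]
    · simp [hx]

theorem readableFrom_zero : ReadableFrom σ 0 := by
  intro S hS _
  have hu : ∀ x, x ∈ S := fun x => by
    have := Finset.card_eq_zero.1 hS
    by_contra hx
    exact absurd (Finset.mem_compl.2 hx) (by simp [this])
  refine ⟨[], List.nodup_nil, fun x => by simp [hu x], fun b L₀ ψ F c hb _ hj hR hc hE => ?_⟩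
  obtain ⟨D, h1, h2, h3, h4⟩ := hR.death (hj 0)
  refine ⟨D, h1, ?_, by simpa using h3, c, hc, fun x => ?_⟩
  · rw [h2]
    ext (x | j) : 1
    · simp [hb x (hu x)]
    · simp [hj j]
  · rw [h4, hE x [] rfl]
    rfl

/-- A new cycle is started by opening a hole: a stringless arm is split off on the left, and the
first leg `a` is placed on the boundary between the two arms. -/
theorem readableFrom_succ {k : ℕ} (h : ReadableWithin σ k) : ReadableFrom σ (k + 1) := by
  intro S hS hσ
  obtain ⟨a, ha⟩ : ∃ a, a ∉ S := by
    have : 0 < Sᶜ.card := by omega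
    obtain ⟨a, ha⟩ := Finset.card_pos.1 this
    exact ⟨a, Finset.mem_compl.1 ha⟩
  -- The arms are 0 and 1; the leg ends interval 1 and leaves the other qubits on interval 2. As
  -- only `a` has been read, it is both the start and the current end of the cycle.
  obtain ⟨L, hL, hLS, hD⟩ := h (insert a S) a a 2 (card_compl_insert ha hS)
    (Finset.mem_insert_self a S) (Finset.mem_insert_self a S) two_ne_zero fun x hx hxa => by
      have hxS : x ∈ S := (Finset.mem_insert.1 hx).resolve_left hxa
      exact ⟨Finset.mem_insert_of_mem (hσ x hxS), fun h => ha (h ▸ hσ x hxS)⟩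
  obtain ⟨h1, h2⟩ := nodup_cons_of_insert ha hL hLS
  refine ⟨a :: L, h1, h2, fun b L₀ ψ F c hb hb' hj hR hc hE => ?_⟩
  have hE' := fun x => ((hE x).evenProj (i := 0) (j := k + 1) (by omega)).evenProj
    (i := 0) (j := 0) (by omega)
  obtain ⟨ψ', c', hc', hR', hE''⟩ := hR.splitLeft.readOut hc hE' a
  have key := hD _ _ _ _ _ ?_ ?_ ?_ ?_ ?_ ?_ hR' hc' hE''
  · simpa using key
  · intro x hx hxa
    have hxS : x ∈ S := (Finset.mem_insert.1 hx).resolve_left hxa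
    have hσx : σ x ≠ a := fun h => by
      have h' : b (Sum.inl x) = b (Sum.inl a) := by rw [hb x hxS, hb' a ha, h]
      exact hxa (Sum.inl_injective (b.injective h'))
    simp [transp_apply, hxa, hb x hxS, hσx]
  · simp [transp_apply, hj]
  · intro x hx
    rw [Finset.mem_insert, not_or] at hx
    simp [transp_apply, hx.1, hb' x hx.2]
  · simp [transp_apply, hj]
  · simp [transp_apply, hj]
  · intro j h0 h2
    by_cases h1 : j = 1
    · subst h1
      simp [transp_apply, hb' a ha]
    · simp [transp_apply, hj, h0, h1, h2]

/-- When the cycle is complete, joining the two arms closes the hole, and the legs on its boundary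
circle form the cycle. -/
theorem readableWithin_of_closed {k : ℕ} (h : ReadableFrom σ k) {S : Finset ι} {a e : ι} {d : ℕ}
    (hS : Sᶜ.card = k) (he : e ∈ S) (hd : d ≠ 0) (hσe : σ e = a)
    (hσ : ∀ x ∈ S, x ≠ a → σ.symm x ∈ S ∧ σ.symm x ≠ e) :
    ∃ L : List ι, L.Nodup ∧ (∀ x, x ∈ L ↔ x ∉ S) ∧
      ∀ (b : Equiv.Perm (ι ⊕ ℕ)) (L₀ : List ι) (ψ : (ι → Bool) → Amp)
        (F : (ι → Bool) → List Bool → ℂ) (c : ℂ),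
        (∀ x ∈ S, x ≠ e → b (Sum.inl x) = Sum.inl (σ x)) → b (Sum.inl e) = Sum.inr d →
        (∀ x, x ∉ S → b (Sum.inl x) = Sum.inl x) → b (Sum.inr 0) = Sum.inl a →
        b (Sum.inr d) = Sum.inr 0 → (∀ j, j ≠ 0 → j ≠ d → b (Sum.inr j) = Sum.inr j) →
        Reach [(0, 0), (d, 4 * k)] b L₀ ψ → c ≠ 0 → (∀ x, Encodes k (F x) c (ψ x)) →
        Drawable σ (L.reverse ++ L₀) fun x => F x (L.map x) := by
  obtain ⟨L, hL, hLS, hD⟩ := h S hS fun x hx => by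
    by_cases hxa : x = a
    · rw [hxa, ← hσe, Equiv.symm_apply_apply]
      exact he
    · exact (hσ x hx hxa).1
  refine ⟨L, hL, hLS, fun b L₀ ψ F c hb hbe hb' h0 hbd hj hR hc hE =>
    hD _ _ _ _ _ ?_ ?_ ?_ hR.join hc hE⟩
  · intro x hx
    by_cases hxe : x = e
    · subst hxe
      simp [delete, transp_apply, hbe, h0, hd, hσe]
    · have hσx : σ x ≠ a := fun h => hxe (σ.injective (h.trans hσe.symm))
      simp [delete, transp_apply, hb x hx hxe, h0, hd, hσx]
  · intro x hx
    have hxa : x ≠ a := fun h => by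
      have h' : b (Sum.inl x) = b (Sum.inr 0) := by rw [hb' x hx, h0, h]
      simpa using b.injective h'
    simp [delete, transp_apply, hb' x hx, h0, hd, hxa]
  · intro j
    by_cases hj0 : j = 0
    · subst hj0
      simp [delete, transp_apply, h0, hd, hbd, hd.symm]
    · by_cases hjd : j = d
      · subst hjd
        simp [delete, transp_apply, h0, hd]
      · simp [delete, transp_apply, h0, hd, hj j hj0 hjd, hj0, hjd]

theorem readableWithin_zero (h : ReadableFrom σ 0) : ReadableWithin σ 0 := by
  intro S a e d hS ha he hd hσ
  refine readableWithin_of_closed h hS he hd ?_ hσ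
  have hu : ∀ x, x ∈ S := fun x => by
    have := Finset.card_eq_zero.1 hS
    by_contra hx
    exact absurd (Finset.mem_compl.2 hx) (by simp [this])
  by_contra hne
  -- With all legs read, σ e ≠ a would contradict the hypothesis that no member of S other than a
  -- has predecessor e; hence the cycle is complete.
  exact (hσ (σ e) (hu _) hne).2 (σ.symm_apply_apply e)

/-- Either the cycle is complete and the hole is closed, or the next leg to be read is σ e, which
becomes the new end of the cycle. -/
theorem readableWithin_succ {k : ℕ} (h : ReadableFrom σ (k + 1)) (h' : ReadableWithin σ k) :
    ReadableWithin σ (k + 1) := by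
  intro S a e d hS ha he hd hσ
  by_cases hσe : σ e = a
  · exact readableWithin_of_closed h hS he hd hσe hσ
  have hl : σ e ∉ S := fun hl => (hσ (σ e) hl hσe).2 (σ.symm_apply_apply e)
  have hle : σ e ≠ e := fun h => hl (h.symm ▸ he)
  obtain ⟨L, hL, hLS, hD⟩ := h' (insert (σ e) S) a (σ e) (d + 1) (card_compl_insert hl hS)
    (Finset.mem_insert_of_mem ha) (Finset.mem_insert_self _ S) (Nat.succ_ne_zero d)
    fun x hx hxa => by
      rcases Finset.mem_insert.1 hx with rfl | hx
      · rw [Equiv.symm_apply_apply]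
        exact ⟨Finset.mem_insert_of_mem he, hle.symm⟩
      · have := (hσ x hx hxa).1
        exact ⟨Finset.mem_insert_of_mem this, fun h => hl (h ▸ this)⟩
  obtain ⟨h1, h2⟩ := nodup_cons_of_insert hl hL hLS
  refine ⟨σ e :: L, h1, h2, fun b L₀ ψ F c hb hbe hb' h0 hbd hj hR hc hE => ?_⟩
  obtain ⟨ψ', c', hc', hR', hE'⟩ := hR.readOut hc hE (σ e)
  have hd1 : b (Sum.inr (d + 1)) = Sum.inr (d + 1) := hj _ (by omega) (by omega)
  have hal : a ≠ σ e := Ne.symm hσe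
  have key := hD _ _ _ _ _ ?_ ?_ ?_ ?_ ?_ ?_ hR' hc' hE'
  · simpa using key
  · intro x hx hxl
    have hxS : x ∈ S := (Finset.mem_insert.1 hx).resolve_left hxl
    by_cases hxe : x = e
    · subst hxe
      simp [transp_apply, hxl, hbe]
    · simp [transp_apply, hxl, hb x hxS hxe, hxe]
  · simp [transp_apply, hd1]
  · intro x hx
    rw [Finset.mem_insert, not_or] at hx
    simp [transp_apply, hx.1, hb' x hx.2]
  · simp [transp_apply, h0, hd.symm, hal]
  · simp [transp_apply, hbd, hd.symm]
  · intro j hj0 hj1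
    by_cases hjd : j = d
    · subst hjd
      simp [transp_apply, hb' _ hl]
    · simp [transp_apply, hj j hj0 hjd, hj1, hjd]

theorem readable (k : ℕ) : ReadableFrom σ k ∧ ReadableWithin σ k := by
  induction k with
  | zero => exact ⟨readableFrom_zero, readableWithin_zero readableFrom_zero⟩
  | succ k ih =>
    exact ⟨readableFrom_succ ih.2, readableWithin_succ (readableFrom_succ ih.2) ih.2⟩

end ReadOut

/-- Any tensor of the form `CliffordSum` is that of a diagram without generic scattering elements,
with any given layout. -/
theorem CliffordSum.exists_diagram [Finite ι] {T : (ι → Bool) → ℂ} (hT : CliffordSum T)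
    (σ : Equiv.Perm ι) : ∃ D : Diagram ι, D.NoGenericScattering ∧ (∀ x, D.tensor x = T x) ∧
      D.body.boundary = Equiv.sumCongr σ 1 := by
  classical
  have := Fintype.ofFinite ι
  -- The order L of the read-out depends only on σ. It is fixed first, and the state is then
  -- prepared with its logical qubits in this order, so that no crossing of legs is needed.
  obtain ⟨L, hL, hmem, hD⟩ := (readable (σ := σ) (Fintype.card ι)).1 ∅
    (by rw [Finset.compl_empty, Finset.card_univ]) (by simp)
  have hmem' : ∀ x, x ∈ L := fun x => (hmem x).2 (by simp)
  set e : Fin L.length ≃ ι := hL.getEquivOfForallMemList L hmem'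
  have hn : Fintype.card ι = L.length := by
    rw [← Fintype.card_congr e, Fintype.card_fin]
  obtain ⟨F, hF, ψ, c, hc, hR, hE⟩ :=
    (Preparable.cliffordClosed (ι := ι)).of_cliffordSum hT e.symm
  rw [← hn] at hR hE
  obtain ⟨D, h1, h2, h3, d, hd, h4⟩ := hD 1 [] ψ (fun _ => F) c (by simp) (by simp)
      (by simp) hR hc hE
  have hFT : ∀ x : ι → Bool, F (L.map x) = T x := fun x => by
    have h : L.map x = List.ofFn fun i => x (e i) := by
      refine List.ext_getElem (by simp) fun k h1 h2 => ?_
      simp [e]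
    rw [h, hF]
    exact congrArg T (funext fun i => by simp)
  refine ⟨⟨d⁻¹, D, ?_, ?_⟩, h1, fun x => ?_, h2⟩
  · rw [h3]
    simpa using hL
  · intro ℓ
    rw [h3]
    simpa using hmem' ℓ
  · simp only [Diagram.tensor]
    rw [h4, inv_mul_cancel_left₀ hd]
    exact hFT x

end Quon

theorem theorem2 {ι : Type} {σ : Equiv.Perm ι} (N : Quon.PlanarTN ι σ) :
    N.IsClifford ↔ ∃ D : Quon.Diagram ι, D.NoGenericScattering ∧ D.Represents N := by
  have := N.finite
  constructor
  -- Only the tensor of M matters, since a diagram exists for every layout; the scalar is absorbed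
  -- into the Clifford sum.
  · rintro ⟨M, hM, c, -, hT⟩
    obtain ⟨D, h1, h2, h3⟩ := (hM.cliffordSum.const_mul c).exists_diagram σ
    exact ⟨D, h1, fun x => (h2 x).trans (hT x).symm, h3⟩
  -- The layout of the diagram can be dropped, since the Clifford sum is realizable with the layout
  -- σ directly.
  · rintro ⟨D, hD, hT, -⟩
    obtain ⟨M, hM, c, hc, hS⟩ := (D.cliffordSum hD).realizable σ
    exact ⟨M, hM, c, hc, fun x => (hT x).symm.trans (hS x)⟩
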